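/- A tournament $T$ on a finite vertex set $V(T)$ is a set $E(T)\subseteq V(T)\times V(T)$ containing no pair $(u,u)$ and exactly one of $(u,v),(v,u)$ for all distinct $u,v$. Write $T[U]$ for the subtournament induced by $U\subseteq V(T)$, $d^+_T(v)$ and $d^-_T(v)$ for the out- and in-degree of $v$, and $e_T(U,W)$ for the number of edges starting in $U$ and ending in $W$. For an ordering of an $n$-vertex tournament $T$, that is a bijection $\sigma:V(T)\to\{1,\dots,n\}$, let $F_{\sigma,T}$ be the set of edges $(u,v)\in E(T)$ with $\sigma(u)<\sigma(v)$ (the forward edges); $T$ is transitive if $F_{\sigma,T}=E(T)$ for some ordering $\sigma$. Let $N^*_T(H)$ be the number of maps $\phi:V(H)\to V(T)$ such that $(u,v)\in E(H)$ if and only if $(\phi(u),\phi(v))\in E(T)$, and let $N^*_T(H;U)=N^*_{T[U]}(H)$. We write $c=a\pm b$ for $a-b\le c\le a+b$. An $h$-vertex tournament $H$ is called locally forcing if for every $\varepsilon>0$ there are $\delta>0$ and $n_0\in\mathbb N$ such that every $n$-vertex tournament $T$ with $n\ge n_0$ which satisfies $$N^*_T(H;U)=2^{-\binom h2}|U|^h\pm\delta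 n^h\quad\text{for every }U\subseteq V(T)$$ also satisfies $$|F_{\sigma,T}|=\tfrac12\tbinom n2\pm\varepsilon n^2\quad\text{for every ordering }\sigma\text{ of }T.$$ Theorem. Every non-transitive locally forcing $h$-vertex tournament $H$ has the following three properties. (i) $\displaystyle\sum_{v\in V(H)}\bigl(d^+_H(v)-d^-_H(v)\bigr)^2\le h(h-1)$. (ii) $|F_{\sigma,H}|=\tfrac12\binom h2\pm h^{3/2}\sqrt{\log h}$ for every ordering $\sigma$ of $H$, where $\log$ is the natural logarithm. (iii) $e_H(U,W)\le\tfrac12|U||W|+2h^{3/2}$ for all disjoint $U,W\subseteq V(H)$. -/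

import Mathlib

/-- A tournament on the vertex set `V`: a set of edges `E ⊆ V × V` without loops which contains
exactly one of `(u, v)` and `(v, u)` for all distinct `u, v`. -/
structure Tournament (V : Type*) where
  /-- the edge set -/
  E : Set (V × V)
  irrefl : ∀ u : V, (u, u) ∉ E
  exactly_one : ∀ u v : V, u ≠ v → Xor ((u, v) ∈ E) ((v, u) ∈ E)

namespace Tournament

variable {V W : Type*}

/-- The subtournament `T[U]` induced by a vertex set `U`. -/
def induce (T : Tournament W) (U : Set W) : Tournament U where
  E := {p | ((p.1 : W), (p.2 : W)) ∈ T.E}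
  irrefl u := T.irrefl u
  exactly_one u v huv := T.exactly_one u v fun h => huv (Subtype.ext h)

/-- `φ` is a labelled embedding of `H` into `T`. -/
def IsLabelledEmbedding (H : Tournament V) (T : Tournament W) (φ : V → W) : Prop :=
  ∀ u v : V, (u, v) ∈ H.E ↔ (φ u, φ v) ∈ T.E

/-- The number `N*_T(H)` of labelled embeddings of `H` into `T`. -/
noncomputable def embCount (H : Tournament V) (T : Tournament W) : ℕ :=
  {φ : V → W | IsLabelledEmbedding H T φ}.ncard

/-- The number `N*_T(H; U)` of labelled embeddings of `H` into `T[U]`. -/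
noncomputable def localEmbCount (H : Tournament V) (T : Tournament W) (U : Set W) : ℕ :=
  H.embCount (T.induce U)

/-- The out-degree `d⁺(u)`. -/
noncomputable def outDegree (T : Tournament V) (u : V) : ℕ :=
  {v : V | (u, v) ∈ T.E}.ncard

/-- The in-degree `d⁻(u)`. -/
noncomputable def inDegree (T : Tournament V) (u : V) : ℕ :=
  {v : V | (v, u) ∈ T.E}.ncard

/-- The number `e(A, B)` of edges starting in `A` and ending in `B`. -/
noncomputable def edgesBetween (T : Tournament V) (A B : Set V) : ℕ :=
  {p : V × V | p ∈ T.E ∧ p.1 ∈ A ∧ p.2 ∈ B}.ncard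

/-- The set `F_{σ,T}` of `σ`-forward edges, for an ordering `σ` of the `n` vertices of `T`. -/
def forwardEdges (T : Tournament V) {n : ℕ} (σ : V ≃ Fin n) : Set (V × V) :=
  {p | p ∈ T.E ∧ σ p.1 < σ p.2}

/-- `T` is transitive: for some ordering of its vertices all edges are forward edges. -/
def IsTransitive [Fintype V] (T : Tournament V) : Prop :=
  ∃ σ : V ≃ Fin (Fintype.card V), T.forwardEdges σ = T.E

/-- The quasirandomness property with error `ε`: every ordering of the `n`-vertex tournament `T`
has `(1/2) * (n choose 2) ± ε * n ^ 2` forward edges. -/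
def ForwardEdgesWithin [Fintype V] (T : Tournament V) (ε : ℝ) : Prop :=
  ∀ σ : V ≃ Fin (Fintype.card V),
    |((T.forwardEdges σ).ncard : ℝ) - 1 / 2 * ((Fintype.card V).choose 2 : ℝ)|
      ≤ ε * (Fintype.card V : ℝ) ^ 2

/-- The local counting property with error `δ`: for every vertex set `U` of the `n`-vertex
tournament `T`, the number of labelled embeddings of the `h`-vertex tournament `H` into `T[U]` is
`2 ^ (-(h choose 2)) * |U| ^ h ± δ * n ^ h`. -/
def LocalCountsWithin [Fintype V] [Fintype W] (H : Tournament V) (T : Tournament W)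
    (δ : ℝ) : Prop :=
  ∀ U : Set W,
    |(H.localEmbCount T U : ℝ)
        - (1 / 2 : ℝ) ^ ((Fintype.card V).choose 2) * (U.ncard : ℝ) ^ Fintype.card V|
      ≤ δ * (Fintype.card W : ℝ) ^ Fintype.card V

/-- `H` is locally forcing: correct local counts of `H` (with error `o(n ^ h)`) force
quasirandomness (error `o(n ^ 2)` in the number of forward edges of every ordering). -/
def IsLocallyForcing [Fintype V] (H : Tournament V) : Prop :=
  ∀ ε : ℝ, 0 < ε → ∃ δ : ℝ, 0 < δ ∧ ∃ n₀ : ℕ,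
    ∀ (X : Type) [Fintype X] (T : Tournament X), n₀ ≤ Fintype.card X →
      LocalCountsWithin H T δ → T.ForwardEdgesWithin ε

end Tournament

namespace Tournament

open scoped Classical

/-! ### Random orderings: moments of the bias and lower bounds for `orderPoly` -/

section Orderings

variable {V : Type*}

/-! Take a random tournament on `Fin n` in which each pair points forward with probability `(1 + y)
/ 2`. Averaging over relabellings of `H`, the expected number of copies of `H` in any `U` is, up to
lower order terms, the truly random count times `P(y) / h!`, where `P` is `orderPoly`. If `P(y) =
h!` for some `0 < y < 1`, all local counts are right while the natural order has about `(y / 2) * (n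
choose 2)` forward edges too many, so `H` is not locally forcing (`IsLocallyForcing.orderPoly_ne`).
For non-transitive `H` one has `P(1) = 0`, and the intermediate value theorem gives `P ≤ h!` on `(0,
1)` (`IsLocallyForcing.orderPoly_le`). All three properties follow from this one inequality.

Property (i) is its second-order part at `y = 0`: the variance of the bias (forward minus backward
edges) of a random ordering is at most the number of edges, and `sum_orderBias_sq` expresses this
variance through the degree differences. For (ii) and (iii), `P` is bounded below by the
contribution of a set of orderings of large average bias (`card_mul_exp_le`): a single ordering for
(ii), and for (iii) all orderings that list three vertex classes one after the other, which are at
least a `4 ^ (-h)` proportion.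

Concentration of the random tournament is replaced by a deterministic rounding of the constant
weight `(1 + y) / 2`, which uses only that the counts are affine and Lipschitz in each pair
(`exists_rounding_le`). -/

lemma ne_of_mem (H : Tournament V) {e : V × V} (he : e ∈ H.E) : e.1 ≠ e.2 := by
  intro h
  apply H.irrefl e.1
  have : e = (e.1, e.1) := by rw [Prod.ext_iff]; exact ⟨rfl, h.symm⟩
  rwa [← this]

lemma asymm (H : Tournament V) {u v : V} (he : (u, v) ∈ H.E) : (v, u) ∉ H.E := by
  rcases H.exactly_one u v (H.ne_of_mem he) with h | h
  · exact h.2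
  · exact absurd he h.2

lemma mem_or_mem (H : Tournament V) {u v : V} (h : u ≠ v) : (u, v) ∈ H.E ∨ (v, u) ∈ H.E := by
  rcases H.exactly_one u v h with h | h
  · exact Or.inl h.1
  · exact Or.inr h.1

variable [Fintype V]

/-- The edge set of a finite tournament as a finset. -/
noncomputable def edges (H : Tournament V) : Finset (V × V) := (Set.toFinite H.E).toFinset

@[simp] lemma mem_edges (H : Tournament V) (e : V × V) : e ∈ H.edges ↔ e ∈ H.E := by
  simp [edges]

/-- The sign of a pair in a linear order: `1` if it is increasing and `-1` otherwise. -/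
noncomputable def osign {α : Type*} [LinearOrder α] (a b : α) : ℝ := if a < b then 1 else -1

lemma osign_of_lt {α : Type*} [LinearOrder α] {a b : α} (h : a < b) : osign a b = 1 :=
  if_pos h

lemma osign_of_gt {α : Type*} [LinearOrder α] {a b : α} (h : b < a) : osign a b = -1 :=
  if_neg h.not_gt

lemma osign_swap {α : Type*} [LinearOrder α] {a b : α} (h : a ≠ b) : osign b a = -osign a b := by
  unfold osign
  rcases lt_or_gt_of_ne h with h | h
  · simp [h, h.not_gt]
  · simp [h, h.not_gt]

lemma osign_mul_self {α : Type*} [LinearOrder α] (a b : α) : osign a b * osign a b = 1 := by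
  unfold osign; split_ifs <;> norm_num

/-- Each product is `1` when its centre is the least or greatest of the three elements and `-1` when
it is the median. -/
lemma osign_triple {α : Type*} [LinearOrder α] {a b c : α} (hab : a ≠ b) (hac : a ≠ c)
    (hbc : b ≠ c) :
    osign a b * osign a c + osign b a * osign b c + osign c b * osign c a = 1 := by
  unfold osign
  rcases lt_or_gt_of_ne hab with h1 | h1 <;> rcases lt_or_gt_of_ne hac with h2 | h2 <;>
    rcases lt_or_gt_of_ne hbc with h3 | h3 <;>
    simp [h1, h2, h3, h1.not_gt, h2.not_gt, h3.not_gt] <;>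
    first | exact absurd (h1.trans h3) h2.not_gt | exact absurd (h3.trans h1) h2.not_gt

/-- Every injection into a linear order is order-equivalent to an ordering. -/
lemma exists_ordering {α : Type*} [LinearOrder α] (a : V → α) (ha : Function.Injective a) :
    ∃ e : V ≃ Fin (Fintype.card V), ∀ u v, e u < e v ↔ a u < a v := by
  let _ : LinearOrder V := LinearOrder.lift' a ha
  let f := Fintype.orderIsoFinOfCardEq V rfl
  exact ⟨f.symm.toEquiv, fun u v => f.symm.lt_iff_lt⟩

/-- The number of forward minus the number of backward edges. -/
noncomputable def orderBias (H : Tournament V) (σ : V ≃ Fin (Fintype.card V)) : ℝ :=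
  ∑ e ∈ H.edges, osign (σ e.1) (σ e.2)

/-- The sum over all orderings `σ` of `(1 + y) ^ f * (1 - y) ^ b`, where `f` and `b` are the
numbers of forward and backward edges. -/
noncomputable def orderPoly (H : Tournament V) (y : ℝ) : ℝ :=
  ∑ σ : V ≃ Fin (Fintype.card V), ∏ e ∈ H.edges, (1 + y * osign (σ e.1) (σ e.2))

lemma card_orderings : Fintype.card (V ≃ Fin (Fintype.card V)) = (Fintype.card V).factorial :=
  Fintype.card_equiv (Fintype.equivFin V)

lemma two_mul_card_edges (H : Tournament V) :
    2 * H.edges.card = Fintype.card V * (Fintype.card V - 1) := by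
  have h1 : H.edges ∪ H.edges.map (Equiv.prodComm V V).toEmbedding
      = (Finset.univ : Finset V).offDiag := by
    ext ⟨u, v⟩
    simp only [Finset.mem_union, mem_edges, Finset.mem_map, Finset.mem_offDiag, Finset.mem_univ,
      true_and]
    constructor
    · rintro (h | ⟨⟨a, b⟩, h, hab⟩)
      · exact H.ne_of_mem h
      · simp at hab
        obtain ⟨rfl, rfl⟩ := hab
        exact (H.ne_of_mem h).symm
    · intro h
      rcases H.mem_or_mem h with h | h
      · exact Or.inl h
      · exact Or.inr ⟨(v, u), h, rfl⟩
  have h2 : Disjoint H.edges (H.edges.map (Equiv.prodComm V V).toEmbedding) := by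
    rw [Finset.disjoint_left]
    rintro ⟨u, v⟩ h h'
    simp only [Finset.mem_map, mem_edges] at h h'
    obtain ⟨⟨a, b⟩, h', hab⟩ := h'
    simp at hab
    obtain ⟨rfl, rfl⟩ := hab
    exact H.asymm h h'
  have h3 := congrArg Finset.card h1
  rw [Finset.card_union_of_disjoint h2, Finset.card_map, Finset.offDiag_card,
    Finset.card_univ] at h3
  rw [Nat.mul_sub, mul_one]
  omega

lemma card_edges (H : Tournament V) : H.edges.card = (Fintype.card V).choose 2 := by
  rw [Nat.choose_two_right, ← two_mul_card_edges H]
  simp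

lemma ncard_forwardEdges (H : Tournament V) (σ : V ≃ Fin (Fintype.card V)) :
    ((H.forwardEdges σ).ncard : ℝ)
      = 1 / 2 * ((Fintype.card V).choose 2 : ℝ) + 1 / 2 * H.orderBias σ := by
  have h1 : H.forwardEdges σ = ↑(H.edges.filter fun e => σ e.1 < σ e.2) := by
    ext e; simp [forwardEdges]
  rw [h1, Set.ncard_coe_finset, ← H.card_edges, orderBias, Finset.card_filter]
  push_cast
  rw [Finset.mul_sum, Finset.card_eq_sum_ones]
  push_cast
  rw [Finset.mul_sum, ← Finset.sum_add_distrib]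
  refine Finset.sum_congr rfl fun e _ => ?_
  unfold osign
  split_ifs <;> norm_num

lemma sum_swap_eq (u v : V) (g : (V ≃ Fin (Fintype.card V)) → ℝ) :
    ∑ σ, g ((Equiv.swap u v).trans σ) = ∑ σ, g σ :=
  Fintype.sum_equiv ((Equiv.swap u v).equivCongr (Equiv.refl _)) _ _ fun σ => by
    congr 1

lemma sum_osign {u v : V} (h : u ≠ v) :
    ∑ σ : V ≃ Fin (Fintype.card V), osign (σ u) (σ v) = 0 := by
  have h1 := sum_swap_eq u v fun σ => osign (σ u) (σ v)
  simp only [Equiv.trans_apply, Equiv.swap_apply_left, Equiv.swap_apply_right] at h1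
  rw [Finset.sum_congr rfl fun σ _ => osign_swap (σ.injective.ne h), Finset.sum_neg_distrib] at h1
  linarith

lemma sum_osign_mul_of_disjoint {u v w x : V} (huv : u ≠ v) (huw : u ≠ w) (hux : u ≠ x)
    (hvw : v ≠ w) (hvx : v ≠ x) :
    ∑ σ : V ≃ Fin (Fintype.card V), osign (σ u) (σ v) * osign (σ w) (σ x) = 0 := by
  have h1 := sum_swap_eq u v fun σ => osign (σ u) (σ v) * osign (σ w) (σ x)
  simp only [Equiv.trans_apply, Equiv.swap_apply_left, Equiv.swap_apply_right,
    Equiv.swap_apply_of_ne_of_ne huw.symm hvw.symm,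
    Equiv.swap_apply_of_ne_of_ne hux.symm hvx.symm] at h1
  rw [Finset.sum_congr rfl fun σ _ => congrArg (· * osign (σ w) (σ x))
    (osign_swap (σ.injective.ne huv))] at h1
  simp only [neg_mul, Finset.sum_neg_distrib] at h1
  linarith

/-- By symmetry each of the three vertices serves equally well as the centre, and for every ordering
the three products add up to `1` by `osign_triple`. -/
lemma sum_osign_mul_of_common {u v w : V} (huv : u ≠ v) (huw : u ≠ w) (hvw : v ≠ w) :
    3 * ∑ σ : V ≃ Fin (Fintype.card V), osign (σ u) (σ v) * osign (σ u) (σ w)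
      = (Fintype.card V).factorial := by
  have h1 := sum_swap_eq u v fun σ => osign (σ u) (σ v) * osign (σ u) (σ w)
  have h2 := sum_swap_eq u w fun σ => osign (σ u) (σ v) * osign (σ u) (σ w)
  simp only [Equiv.trans_apply, Equiv.swap_apply_left, Equiv.swap_apply_right,
    Equiv.swap_apply_of_ne_of_ne huw.symm hvw.symm,
    Equiv.swap_apply_of_ne_of_ne huv.symm hvw] at h1 h2
  have h3 := Finset.sum_congr (rfl : (Finset.univ : Finset (V ≃ Fin (Fintype.card V))) = _)
    fun σ _ => osign_triple (σ.injective.ne huv) (σ.injective.ne huw) (σ.injective.ne hvw)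
  rw [Finset.sum_add_distrib, Finset.sum_add_distrib, h1, h2] at h3
  simp only [Finset.sum_const, Finset.card_univ, card_orderings, nsmul_eq_mul, mul_one] at h3
  linarith

/-- The signed incidence vector of a pair. -/
noncomputable def incidence (e : V × V) (v : V) : ℝ :=
  (if e.1 = v then 1 else 0) - (if e.2 = v then 1 else 0)

lemma sum_incidence_mul (e f : V × V) :
    ∑ v, incidence e v * incidence f v = (if e.1 = f.1 then 1 else 0)
      - (if e.1 = f.2 then 1 else 0) - (if e.2 = f.1 then 1 else 0)
      + (if e.2 = f.2 then 1 else 0) := by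
  simp only [incidence, sub_mul, mul_sub, Finset.sum_sub_distrib, ite_mul, one_mul, zero_mul,
    Finset.sum_ite_eq, Finset.mem_univ, if_true, eq_comm (a := f.1), eq_comm (a := f.2)]
  ring

/-- The correlation of two edge signs is `1` for equal edges, `±1/3` for edges sharing one vertex
and `0` for disjoint edges. The inner product of incidence vectors is `2`, `±1` and `0` in these
cases. Antiparallel edges, where the formula fails, do not occur in a tournament. -/
lemma sum_osign_mul (H : Tournament V) {e f : V × V} (he : e ∈ H.E) (hf : f ∈ H.E) :
    3 * ∑ σ : V ≃ Fin (Fintype.card V), osign (σ e.1) (σ e.2) * osign (σ f.1) (σ f.2)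
      = (Fintype.card V).factorial
        * (∑ v, incidence e v * incidence f v + if e = f then 1 else 0) := by
  obtain ⟨u, v⟩ := e
  obtain ⟨w, x⟩ := f
  have huv : u ≠ v := H.ne_of_mem he
  have hwx : w ≠ x := H.ne_of_mem hf
  rw [sum_incidence_mul]
  have hsw : ∀ {a b : V}, a ≠ b → ∀ σ : V ≃ Fin (Fintype.card V),
      osign (σ a) (σ b) = -osign (σ b) (σ a) := fun h σ => osign_swap (σ.injective.ne h.symm)
  by_cases huw : u = w
  · subst huw
    by_cases hvx : v = x
    · subst hvx
      simp [osign_mul_self, huv, huv.symm]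
      ring
    · rw [sum_osign_mul_of_common huv hwx hvx]
      simp [huv.symm, hwx, hvx]
  by_cases hux : u = x
  · subst hux
    by_cases hvw : v = w
    · subst hvw
      exact absurd hf (H.asymm he)
    · have := sum_osign_mul_of_common huv (Ne.symm hwx) hvw
      simp only [hsw hwx, mul_neg, Finset.sum_neg_distrib]
      rw [this]
      simp [huv.symm, huw, hvw]
  by_cases hvw : v = w
  · subst hvw
    have := sum_osign_mul_of_common huv.symm hwx hux
    simp only [hsw huv, neg_mul, mul_neg, Finset.sum_neg_distrib]
    rw [this]
    simp [huv, hux, hwx]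
  by_cases hvx : v = x
  · subst hvx
    have := sum_osign_mul_of_common huv.symm hwx.symm huw
    simp only [hsw huv, hsw hwx, neg_mul_neg]
    rw [this]
    simp [huv, huw, hvw]
  rw [sum_osign_mul_of_disjoint huv huw hux hvw hvx]
  simp [huw, hux, hvw, hvx]

lemma outDegree_sub_inDegree (H : Tournament V) (v : V) :
    ((H.outDegree v : ℝ) - H.inDegree v) = ∑ e ∈ H.edges, incidence e v := by
  have h1 : H.outDegree v = (H.edges.filter fun e => e.1 = v).card := by
    rw [outDegree, ← Set.ncard_coe_finset, ← Set.ncard_image_of_injective _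
      (Prod.mk_right_injective v)]
    congr 1
    ext ⟨a, b⟩
    simp
    constructor
    · rintro ⟨h, rfl⟩; exact ⟨h, rfl⟩
    · rintro ⟨h, rfl⟩; exact ⟨h, rfl⟩
  have h2 : H.inDegree v = (H.edges.filter fun e => e.2 = v).card := by
    rw [inDegree, ← Set.ncard_coe_finset, ← Set.ncard_image_of_injective _
      (Prod.mk_left_injective v)]
    congr 1
    ext ⟨a, b⟩
    simp
    constructor
    · rintro ⟨h, rfl⟩; exact ⟨h, rfl⟩
    · rintro ⟨h, rfl⟩; exact ⟨h, rfl⟩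
  rw [h1, h2, Finset.card_filter, Finset.card_filter]
  simp [incidence]

/-- The second moment of the bias of a random ordering. -/
lemma sum_orderBias_sq (H : Tournament V) :
    3 * ∑ σ, H.orderBias σ ^ 2 = (Fintype.card V).factorial *
      (∑ v, ((H.outDegree v : ℝ) - H.inDegree v) ^ 2 + H.edges.card) := by
  have h1 : ∑ σ, H.orderBias σ ^ 2 = ∑ e ∈ H.edges, ∑ f ∈ H.edges,
      ∑ σ : V ≃ Fin (Fintype.card V), osign (σ e.1) (σ e.2) * osign (σ f.1) (σ f.2) := by
    simp only [orderBias, sq, Finset.sum_mul_sum]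
    rw [Finset.sum_comm]
    exact Finset.sum_congr rfl fun e _ => Finset.sum_comm
  -- The vector of degree differences is the sum of the incidence vectors, so its squared norm is
  -- the sum of their Gram matrix.
  have h2 : ∑ v, ((H.outDegree v : ℝ) - H.inDegree v) ^ 2 = ∑ e ∈ H.edges, ∑ f ∈ H.edges,
      ∑ v, incidence e v * incidence f v := by
    simp only [outDegree_sub_inDegree, sq, Finset.sum_mul_sum]
    rw [Finset.sum_comm]
    exact Finset.sum_congr rfl fun e _ => Finset.sum_comm
  have h3 : (H.edges.card : ℝ) = ∑ e ∈ H.edges, ∑ f ∈ H.edges, if e = f then 1 else 0 := by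
    rw [Finset.card_eq_sum_ones]
    push_cast
    refine Finset.sum_congr rfl fun e he => ?_
    simp only [Finset.sum_ite_eq, he, if_true]
  rw [h1, h2, h3, ← Finset.sum_add_distrib]
  simp only [← Finset.sum_add_distrib, Finset.mul_sum]
  refine Finset.sum_congr rfl fun e he => Finset.sum_congr rfl fun f hf => ?_
  have := H.sum_osign_mul ((H.mem_edges e).1 he) ((H.mem_edges f).1 hf)
  simp only [Finset.mul_sum, mul_add] at this ⊢
  exact this

lemma sum_orderBias (H : Tournament V) : ∑ σ, H.orderBias σ = 0 := by
  unfold orderBias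
  rw [Finset.sum_comm]
  exact Finset.sum_eq_zero fun e he => sum_osign (H.ne_of_mem ((H.mem_edges e).1 he))

/-- Second-order expansion of a product `∏ (1 + y * s i)` with a continuous remainder. -/
lemma exists_prod_one_add_expansion {ι : Type*} (S : Finset ι) (s : ι → ℝ) :
    ∃ r : ℝ → ℝ, Continuous r ∧ ∀ y, ∏ i ∈ S, (1 + y * s i)
      = 1 + y * ∑ i ∈ S, s i + y ^ 2 * (((∑ i ∈ S, s i) ^ 2 - ∑ i ∈ S, s i ^ 2) / 2)
        + y ^ 3 * r y := by
  induction S using Finset.induction_on with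
  | empty => exact ⟨fun _ => 0, continuous_const, fun y => by simp⟩
  | insert a S ha ih =>
    obtain ⟨r, hr, h⟩ := ih
    refine ⟨fun y => r y + s a * (((∑ i ∈ S, s i) ^ 2 - ∑ i ∈ S, s i ^ 2) / 2) + y * s a * r y,
      by fun_prop, fun y => ?_⟩
    rw [Finset.prod_insert ha, Finset.sum_insert ha, Finset.sum_insert ha, h]
    ring

/-- The linear term of `orderPoly` at `0` vanishes because the biases sum to zero, and since signs
square to `1` the quadratic coefficient is `K / 2`. Dividing by `y ^ 2` and letting `y` tend to `0`
from the right gives `K ≤ 0`. -/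
lemma sum_orderBias_sq_le (H : Tournament V)
    (hP : ∀ y : ℝ, 0 < y → y < 1 → H.orderPoly y ≤ (Fintype.card V).factorial) :
    ∑ σ, H.orderBias σ ^ 2 ≤ (Fintype.card V).factorial * H.edges.card := by
  choose r hr h using fun σ : V ≃ Fin (Fintype.card V) =>
    exists_prod_one_add_expansion H.edges fun e => osign (σ e.1) (σ e.2)
  set K := ∑ σ, H.orderBias σ ^ 2 - (Fintype.card V).factorial * H.edges.card with hK
  have hsum : ∀ y, H.orderPoly y = (Fintype.card V).factorial + y ^ 2 * (K / 2)
      + y ^ 3 * ∑ σ, r σ y := by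
    intro y
    have h0 := H.sum_orderBias
    unfold orderPoly
    simp only [h, Finset.sum_add_distrib, ← Finset.mul_sum]
    simp only [pow_two (osign _ _), osign_mul_self]
    unfold orderBias at h0 hK
    rw [h0, ← Finset.sum_div, Finset.sum_sub_distrib, hK]
    simp
  have hle : ∀ y : ℝ, 0 < y → y < 1 → K / 2 + y * ∑ σ, r σ y ≤ 0 := by
    intro y hy0 hy1
    have h1 := hP y hy0 hy1
    rw [hsum] at h1
    by_contra! hc
    nlinarith [mul_pos (pow_pos hy0 2) hc]
  have hcont : Continuous fun y : ℝ => K / 2 + y * ∑ σ, r σ y := by fun_prop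
  have hlim : Filter.Tendsto (fun y : ℝ => K / 2 + y * ∑ σ, r σ y) (nhdsWithin 0 (Set.Ioi 0))
      (nhds (K / 2 + 0 * ∑ σ, r σ 0)) := (hcont.tendsto 0).mono_left nhdsWithin_le_nhds
  have := le_of_tendsto hlim (by
    filter_upwards [Ioo_mem_nhdsGT (zero_lt_one' ℝ)] with y hy using hle y hy.1 hy.2)
  linarith

lemma sum_degree_difference_sq_le (H : Tournament V)
    (hP : ∀ y : ℝ, 0 < y → y < 1 → H.orderPoly y ≤ (Fintype.card V).factorial) :
    ∑ v : V, ((H.outDegree v : ℤ) - (H.inDegree v : ℤ)) ^ 2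
      ≤ (Fintype.card V : ℤ) * ((Fintype.card V : ℤ) - 1) := by
  have h1 := H.sum_orderBias_sq_le hP
  have h2 := H.sum_orderBias_sq
  have h3 : (0 : ℝ) < (Fintype.card V).factorial := by exact_mod_cast Nat.factorial_pos _
  have h4 : ∑ v, ((H.outDegree v : ℝ) - H.inDegree v) ^ 2 ≤ 2 * H.edges.card := by
    by_contra! hc
    nlinarith [mul_pos h3 (sub_pos.2 hc)]
  have h5 : (2 * H.edges.card : ℤ) = (Fintype.card V : ℤ) * ((Fintype.card V : ℤ) - 1) := by
    rcases Nat.eq_zero_or_pos (Fintype.card V) with h | h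
    · have := H.two_mul_card_edges
      simp [h] at this ⊢
      exact this
    · have := H.two_mul_card_edges
      zify [h] at this
      exact this
  rw [← h5]
  exact_mod_cast h4

/-- Convexity bound: a set `G` of orderings with large average bias forces `orderPoly` to be
large. -/
lemma card_mul_exp_le (H : Tournament V) {y : ℝ} (hy : 0 < y) (hy2 : y ^ 2 ≤ 1 / 2)
    (G : Finset (V ≃ Fin (Fintype.card V))) {m : ℝ} (hm : 0 ≤ m)
    (hG : G.card * m ≤ ∑ σ ∈ G, H.orderBias σ) :
    G.card * Real.exp (y * m - H.edges.card * y ^ 2) ≤ H.orderPoly y := by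
  have hy1 : y < 1 := by nlinarith
  have hp : 0 < 1 + y := by linarith
  have hq : 0 < 1 - y := by linarith
  -- Chosen so that `α + β = log (1 + y)` and `α - β = log (1 - y)`; each summand of `orderPoly`
  -- then becomes an exponential of an affine function of the bias.
  set α := (Real.log (1 + y) + Real.log (1 - y)) / 2 with hα
  set β := (Real.log (1 + y) - Real.log (1 - y)) / 2 with hβ
  have hfac : ∀ σ : V ≃ Fin (Fintype.card V), ∏ e ∈ H.edges, (1 + y * osign (σ e.1) (σ e.2))
      = Real.exp (H.edges.card * α + β * H.orderBias σ) := by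
    intro σ
    have : (H.edges.card * α + β * H.orderBias σ)
        = ∑ e ∈ H.edges, (α + β * osign (σ e.1) (σ e.2)) := by
      rw [Finset.sum_add_distrib, ← Finset.mul_sum]
      simp [orderBias]
    rw [this, Real.exp_sum]
    refine Finset.prod_congr rfl fun e _ => ?_
    unfold osign
    split_ifs
    · rw [show α + β * 1 = Real.log (1 + y) by rw [hα, hβ]; ring, Real.exp_log hp, mul_one]
    · rw [show α + β * -1 = Real.log (1 - y) by rw [hα, hβ]; ring, Real.exp_log hq]; ring
  have hαle : -y ^ 2 ≤ α := by
    have h1 : 0 < 1 - y ^ 2 := by linarith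
    have h2 := Real.one_sub_inv_le_log_of_pos h1
    have h3 : Real.log (1 - y ^ 2) = 2 * α := by
      rw [show 1 - y ^ 2 = (1 + y) * (1 - y) by ring, Real.log_mul hp.ne' hq.ne', hα]; ring
    have h4 : (1 - y ^ 2)⁻¹ ≤ 1 + 2 * y ^ 2 := by
      rw [inv_le_iff_one_le_mul₀ h1]
      nlinarith [sq_nonneg y]
    linarith
  have hβle : y ≤ β := by
    have h1 := Real.sum_range_le_log_div hy.le hy1 1
    rw [Real.log_div hp.ne' hq.ne'] at h1
    simp at h1
    rw [hβ]; linarith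
  set M := H.edges.card * α + β * m with hM
  have hM' : y * m - H.edges.card * y ^ 2 ≤ M := by
    have h1 : (0 : ℝ) ≤ H.edges.card := Nat.cast_nonneg _
    nlinarith
  calc G.card * Real.exp (y * m - H.edges.card * y ^ 2) ≤ G.card * Real.exp M := by gcongr
    -- Tangent line of the exponential at bias `m`: its average over `G` is at least `exp M`, since
    -- the average bias is at least `m` and `β ≥ 0`.
    _ ≤ ∑ σ ∈ G, Real.exp M * (1 + β * (H.orderBias σ - m)) := by
        rw [← Finset.mul_sum, Finset.sum_add_distrib, ← Finset.mul_sum, Finset.sum_sub_distrib]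
        simp only [Finset.sum_const, nsmul_eq_mul, mul_one]
        have h1 := (Real.exp_pos M).le
        have h2 : 0 ≤ β := hy.le.trans hβle
        nlinarith [mul_nonneg h1 (mul_nonneg h2 (sub_nonneg.2 hG))]
    _ ≤ ∑ σ ∈ G, ∏ e ∈ H.edges, (1 + y * osign (σ e.1) (σ e.2)) := by
        refine Finset.sum_le_sum fun σ _ => ?_
        rw [hfac, show H.edges.card * α + β * H.orderBias σ = M + β * (H.orderBias σ - m) by
          rw [hM]; ring, Real.exp_add M]
        have := Real.add_one_le_exp (β * (H.orderBias σ - m))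
        exact mul_le_mul_of_nonneg_left (by linarith) (Real.exp_pos M).le
    _ ≤ H.orderPoly y := by
        refine Finset.sum_le_univ_sum_of_nonneg fun σ => ?_
        rw [hfac]; positivity

end Orderings

/-! ### Forward edges and edges between disjoint sets, from the bound on `orderPoly` -/

section Consequences

variable {V : Type*} [Fintype V]

lemma two_mul_card_edges_le_sq (H : Tournament V) :
    (2 * H.edges.card : ℝ) ≤ (Fintype.card V : ℝ) ^ 2 := by
  have := H.two_mul_card_edges
  have h : 2 * H.edges.card ≤ Fintype.card V ^ 2 := by
    rw [this, sq]; exact Nat.mul_le_mul_left _ (Nat.sub_le _ _)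
  exact_mod_cast h

lemma isTransitive_of_card_le_one (H : Tournament V) (h : Fintype.card V ≤ 1) :
    H.IsTransitive := by
  refine ⟨Fintype.equivFin V, ?_⟩
  have := Fintype.card_le_one_iff_subsingleton.1 h
  ext e
  simp only [forwardEdges, Set.mem_ofPred_eq, and_iff_left_iff_imp]
  exact fun he => absurd (Subsingleton.elim _ _) (H.ne_of_mem he)

lemma rpow_three_halves {x : ℝ} (hx : 0 ≤ x) : x ^ (3 / 2 : ℝ) = x * √x := by
  rcases hx.eq_or_lt with rfl | hx
  · norm_num
  · rw [show (3 / 2 : ℝ) = 1 + 1 / 2 by norm_num, Real.rpow_add hx, Real.rpow_one,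
      Real.sqrt_eq_rpow]

lemma log_le_half {x : ℝ} (hx : 0 < x) : Real.log x ≤ x / 2 := by
  have h1 := Real.log_le_sub_one_of_pos (half_pos hx)
  rw [Real.log_div hx.ne' two_ne_zero] at h1
  have := Real.log_two_lt_d9
  linarith

/-- A single ordering with larger bias would contribute more than `h ^ h ≥ h!` to `orderPoly`. At `y
= √(log h / h)` the gain is `y * m = 2 h log h`, while the loss from `y ^ 2` is at most `h log h /
2`. -/
lemma orderBias_le (H : Tournament V) (h2 : 2 ≤ Fintype.card V)
    (hP : ∀ y : ℝ, 0 < y → y < 1 → H.orderPoly y ≤ (Fintype.card V).factorial)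
    (σ : V ≃ Fin (Fintype.card V)) :
    H.orderBias σ ≤ 2 * ((Fintype.card V : ℝ) ^ (3 / 2 : ℝ)
      * √(Real.log (Fintype.card V : ℝ))) := by
  set h : ℝ := (Fintype.card V : ℝ) with hh
  have h2' : (2 : ℝ) ≤ h := by rw [hh]; exact_mod_cast h2
  have h0 : 0 < h := by linarith
  have hl : 0 < Real.log h := Real.log_pos (by linarith)
  rw [rpow_three_halves h0.le]
  by_contra! hc
  set m := 2 * (h * √h * √(Real.log h)) with hm
  set y := √(Real.log h) / √h with hy
  have hsh : 0 < √h := Real.sqrt_pos.2 h0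
  have hsl : 0 < √(Real.log h) := Real.sqrt_pos.2 hl
  have hy0 : 0 < y := by positivity
  have hyy : y ^ 2 = Real.log h / h := by
    rw [hy, div_pow, Real.sq_sqrt hl.le, Real.sq_sqrt h0.le]
  have hy2 : y ^ 2 ≤ 1 / 2 := by
    rw [hyy, div_le_iff₀ h0]
    linarith [log_le_half h0]
  have hym : y * m = 2 * (h * Real.log h) := by
    rw [hm, hy]
    field_simp
    rw [Real.sq_sqrt hl.le]
  have hN : H.edges.card * y ^ 2 ≤ h * Real.log h / 2 := by
    have := H.two_mul_card_edges_le_sq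
    calc (H.edges.card : ℝ) * y ^ 2 ≤ h ^ 2 / 2 * y ^ 2 := by gcongr; linarith
      _ = _ := by rw [hyy]; field_simp
  have key := H.card_mul_exp_le hy0 hy2 {σ} (m := m) (by positivity) (by simpa using hc.le)
  have hpos : 0 < h * Real.log h := by positivity
  have hlt : h ^ (Fintype.card V) < Real.exp (y * m - H.edges.card * y ^ 2) := by
    rw [← Real.exp_log (pow_pos h0 _), Real.exp_lt_exp, Real.log_pow]
    linarith
  have hfac : ((Fintype.card V).factorial : ℝ) ≤ h ^ (Fintype.card V) := by
    rw [hh]; exact_mod_cast Nat.factorial_le_pow _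
  have := hP y hy0 (by nlinarith)
  simp only [Finset.card_singleton, Nat.cast_one, one_mul] at key
  linarith

lemma orderBias_trans_rev (H : Tournament V) (σ : V ≃ Fin (Fintype.card V)) :
    H.orderBias (σ.trans Fin.revPerm) = -H.orderBias σ := by
  unfold orderBias
  rw [← Finset.sum_neg_distrib]
  refine Finset.sum_congr rfl fun e he => ?_
  rw [← osign_swap (σ.injective.ne (H.ne_of_mem ((H.mem_edges e).1 he)))]
  simp [osign, Fin.rev_lt_rev]

lemma abs_ncard_forwardEdges_sub_le (H : Tournament V) (h2 : 2 ≤ Fintype.card V)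
    (hP : ∀ y : ℝ, 0 < y → y < 1 → H.orderPoly y ≤ (Fintype.card V).factorial)
    (σ : V ≃ Fin (Fintype.card V)) :
    |((H.forwardEdges σ).ncard : ℝ) - 1 / 2 * ((Fintype.card V).choose 2 : ℝ)|
      ≤ (Fintype.card V : ℝ) ^ (3 / 2 : ℝ) * √(Real.log (Fintype.card V : ℝ)) := by
  have h3 := H.orderBias_le h2 hP σ
  have h4 := H.orderBias_le h2 hP (σ.trans Fin.revPerm)
  rw [orderBias_trans_rev] at h4
  rw [ncard_forwardEdges, abs_le]
  constructor <;> linarith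

/-- The orderings which list the colour classes of `c` one after the other. -/
noncomputable def monotoneOrderings (c : V → Fin 3) : Finset (V ≃ Fin (Fintype.card V)) :=
  Finset.univ.filter fun σ => ∀ u v, c u < c v → σ u < σ v

lemma exists_mem_monotoneOrderings (c : V → Fin 3) : ∃ σ, σ ∈ monotoneOrderings c := by
  obtain ⟨e, he⟩ := exists_ordering
    (fun u : V => (toLex (c u, Fintype.equivFin V u) : Fin 3 ×ₗ Fin (Fintype.card V)))
    (fun u v huv => by
      have := congrArg (fun p => (ofLex p).2) huv
      exact (Fintype.equivFin V).injective this)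
  refine ⟨e, ?_⟩
  simp only [monotoneOrderings, Finset.mem_filter, Finset.mem_univ, true_and]
  intro u v huv
  rw [he, Prod.Lex.toLex_lt_toLex]
  exact Or.inl huv

/-- Permuting vertices within the colour classes of one monotone ordering gives `n₀! n₁! n₂!` of
them, and the multinomial coefficient is a product of two binomials, each at most `2 ^ h`. -/
lemma factorial_le_card_monotoneOrderings (c : V → Fin 3) :
    (Fintype.card V).factorial ≤ 4 ^ Fintype.card V * (monotoneOrderings c).card := by
  obtain ⟨σ, hσ⟩ := exists_mem_monotoneOrderings c
  simp only [monotoneOrderings, Finset.mem_filter, Finset.mem_univ, true_and] at hσ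
  have h1 : Fintype.card {g : Equiv.Perm V // c ∘ g = c} ≤ (monotoneOrderings c).card := by
    rw [← Fintype.card_coe]
    refine Fintype.card_le_of_injective (fun g => ⟨g.1.trans σ, ?_⟩) ?_
    · simp only [monotoneOrderings, Finset.mem_filter, Finset.mem_univ, true_and,
        Equiv.trans_apply]
      intro u v huv
      refine hσ _ _ ?_
      have h1 := congrFun g.2 u
      have h2 := congrFun g.2 v
      simp only [Function.comp_apply] at h1 h2
      rwa [h1, h2]
    · intro g g' hgg
      have := congrArg Subtype.val hgg
      refine Subtype.ext (Equiv.ext fun v => σ.injective ?_)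
      exact congrArg (fun τ : V ≃ Fin (Fintype.card V) => τ v) this
  rw [DomMulAct.stabilizer_card] at h1
  have h2 : Fintype.card V = ∑ i : Fin 3, Fintype.card {a // c a = i} := by
    rw [← Fintype.card_sigma]
    exact Fintype.card_congr (Equiv.sigmaFiberEquiv c).symm
  rw [Fin.sum_univ_three] at h2
  rw [Fin.prod_univ_three] at h1
  generalize (monotoneOrderings c).card = k at h1 ⊢
  generalize Fintype.card {a // c a = 0} = n₀ at h1 h2
  generalize Fintype.card {a // c a = 1} = n₁ at h1 h2
  generalize Fintype.card {a // c a = 2} = n₂ at h1 h2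
  rw [h2]
  have h3 := Nat.add_choose_mul_factorial_mul_factorial (n₀ + n₁) n₂
  have h4 := Nat.add_choose_mul_factorial_mul_factorial n₀ n₁
  have h5 := Nat.choose_le_two_pow (n₀ + n₁ + n₂) n₂
  have h6 : (n₀ + n₁).choose n₁ ≤ 2 ^ (n₀ + n₁ + n₂) :=
    (Nat.choose_le_two_pow _ _).trans (Nat.pow_le_pow_right two_pos (Nat.le_add_right _ _))
  calc (n₀ + n₁ + n₂).factorial
      = (n₀ + n₁ + n₂).choose n₂ * (n₀ + n₁).choose n₁
          * (n₀.factorial * n₁.factorial * n₂.factorial) := by rw [← h3, ← h4]; ring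
    _ ≤ 2 ^ (n₀ + n₁ + n₂) * 2 ^ (n₀ + n₁ + n₂) * k := by gcongr
    _ = _ := by rw [← mul_pow]; norm_num

/-- The sign of `b - a`. -/
noncomputable def colourSign (a b : Fin 3) : ℝ := if a < b then 1 else if b < a then -1 else 0

lemma sum_monotoneOrderings_osign (c : V → Fin 3) {u v : V} (h : u ≠ v) :
    ∑ σ ∈ monotoneOrderings c, osign (σ u) (σ v)
      = (monotoneOrderings c).card * colourSign (c u) (c v) := by
  have hmem : ∀ {σ}, σ ∈ monotoneOrderings c → ∀ u v, c u < c v → σ u < σ v := fun hσ => by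
    simpa [monotoneOrderings] using hσ
  rcases lt_trichotomy (c u) (c v) with hc | hc | hc
  · rw [Finset.sum_congr rfl fun σ hσ => osign_of_lt (hmem hσ u v hc)]
    simp [colourSign, hc]
  · have hswap : ∀ x, c (Equiv.swap u v x) = c x := fun x => by
      rw [Equiv.swap_apply_def]
      split_ifs with h1 h2
      · rw [h1, hc]
      · rw [h2, hc]
      · rfl
    rw [show colourSign (c u) (c v) = 0 by simp [colourSign, hc], mul_zero]
    -- For two vertices of one class, swapping them preserves monotonicity and reverses the sign.
    refine Finset.sum_involution (fun σ _ => (Equiv.swap u v).trans σ) ?_ ?_ ?_ ?_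
    · intro σ _
      simp [osign_swap (σ.injective.ne h)]
    · intro σ _ _ heq
      have := congrArg (fun τ : V ≃ Fin (Fintype.card V) => τ u) heq
      simp only [Equiv.trans_apply, Equiv.swap_apply_left] at this
      exact h (σ.injective this).symm
    · intro σ hσ
      simp only [monotoneOrderings, Finset.mem_filter, Finset.mem_univ, true_and,
        Equiv.trans_apply]
      intro a b hab
      exact hmem hσ _ _ (by rwa [hswap, hswap])
    · intro σ _
      ext x
      simp
  · rw [Finset.sum_congr rfl fun σ hσ => osign_of_gt (hmem hσ v u hc)]
    simp [colourSign, hc, hc.not_gt]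

lemma sum_monotoneOrderings_orderBias (H : Tournament V) (c : V → Fin 3) :
    ∑ σ ∈ monotoneOrderings c, H.orderBias σ
      = (monotoneOrderings c).card * ∑ e ∈ H.edges, colourSign (c e.1) (c e.2) := by
  unfold orderBias
  rw [Finset.sum_comm, Finset.mul_sum]
  exact Finset.sum_congr rfl fun e he =>
    sum_monotoneOrderings_osign c (H.ne_of_mem ((H.mem_edges e).1 he))

/-- The sum is the average bias over `monotoneOrderings c`. At `y = 1 / (2√h)` a larger value would
give a factor of at least `exp (2h - h/8)`, which beats the loss `4 ^ h` in the number of orderings.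
Averaging over this set instead of using one ordering saves the logarithm. -/
lemma sum_colourSign_le (H : Tournament V) (h2 : 2 ≤ Fintype.card V)
    (hP : ∀ y : ℝ, 0 < y → y < 1 → H.orderPoly y ≤ (Fintype.card V).factorial)
    (c : V → Fin 3) :
    ∑ e ∈ H.edges, colourSign (c e.1) (c e.2) ≤ 4 * (Fintype.card V : ℝ) ^ (3 / 2 : ℝ) := by
  set h : ℝ := (Fintype.card V : ℝ) with hh
  have h2' : (2 : ℝ) ≤ h := by rw [hh]; exact_mod_cast h2
  have h0 : 0 < h := by linarith
  have hsh : 0 < √h := Real.sqrt_pos.2 h0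
  rw [rpow_three_halves h0.le]
  by_contra! hc
  set m := 4 * (h * √h) with hm
  set y := 1 / (2 * √h) with hy
  have hy0 : 0 < y := by positivity
  have hyy : y ^ 2 = 1 / (4 * h) := by
    rw [hy, div_pow, mul_pow, Real.sq_sqrt h0.le]; norm_num
  have hy2 : y ^ 2 ≤ 1 / 2 := by
    rw [hyy, div_le_iff₀ (by positivity)]
    linarith
  have hym : y * m = 2 * h := by
    rw [hm, hy]
    field_simp
    norm_num
  have hN : H.edges.card * y ^ 2 ≤ h / 8 := by
    have := H.two_mul_card_edges_le_sq
    calc (H.edges.card : ℝ) * y ^ 2 ≤ h ^ 2 / 2 * y ^ 2 := by gcongr; linarith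
      _ = _ := by rw [hyy]; field_simp; norm_num
  have key := H.card_mul_exp_le hy0 hy2 (monotoneOrderings c) (m := m) (by positivity) (by
    rw [sum_monotoneOrderings_orderBias]
    exact mul_le_mul_of_nonneg_left hc.le (Nat.cast_nonneg _))
  have hcard : (0 : ℝ) < (monotoneOrderings c).card := by
    obtain ⟨σ, hσ⟩ := exists_mem_monotoneOrderings c
    exact_mod_cast Finset.card_pos.2 ⟨σ, hσ⟩
  have hlt : (4 : ℝ) ^ (Fintype.card V) < Real.exp (y * m - H.edges.card * y ^ 2) := by
    rw [← Real.exp_log (pow_pos (by norm_num : (0 : ℝ) < 4) _), Real.exp_lt_exp, Real.log_pow,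
      show (4 : ℝ) = 2 ^ 2 by norm_num, Real.log_pow]
    have := Real.log_two_lt_d9
    push_cast
    nlinarith
  have hfac : ((Fintype.card V).factorial : ℝ) ≤ 4 ^ Fintype.card V * (monotoneOrderings c).card :=
    by exact_mod_cast factorial_le_card_monotoneOrderings c
  have h3 := hP y hy0 (by nlinarith)
  nlinarith [mul_lt_mul_of_pos_left hlt hcard]

lemma edgesBetween_eq (H : Tournament V) (A B : Set V) :
    (H.edgesBetween A B : ℝ) = ∑ e ∈ H.edges, if e.1 ∈ A ∧ e.2 ∈ B then 1 else 0 := by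
  have : {p : V × V | p ∈ H.E ∧ p.1 ∈ A ∧ p.2 ∈ B}
      = ↑(H.edges.filter fun e => e.1 ∈ A ∧ e.2 ∈ B) := by
    ext e; simp
  rw [edgesBetween, this, Set.ncard_coe_finset, Finset.card_filter]
  push_cast
  rfl

lemma edgesBetween_add_edgesBetween (H : Tournament V) {A B : Set V} (hAB : Disjoint A B) :
    H.edgesBetween A B + H.edgesBetween B A = A.ncard * B.ncard := by
  have h1 : H.edgesBetween B A = {p : V × V | (p.2, p.1) ∈ H.E ∧ p.1 ∈ A ∧ p.2 ∈ B}.ncard := by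
    rw [edgesBetween, ← Set.ncard_image_of_injective _ (Equiv.prodComm V V).injective]
    congr 1
    ext ⟨a, b⟩
    simp
    tauto
  rw [h1, edgesBetween, ← Set.ncard_prod, ← Set.ncard_union_eq _ (Set.toFinite _) (Set.toFinite _)]
  · congr 1
    ext ⟨a, b⟩
    simp only [Set.mem_union, Set.mem_ofPred_eq, Set.mem_prod]
    constructor
    · rintro (h | h) <;> exact h.2
    · intro h
      have hne : a ≠ b := fun hab => Set.disjoint_left.1 hAB h.1 (hab ▸ h.2)
      rcases H.mem_or_mem hne with h' | h'
      · exact Or.inl ⟨h', h⟩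
      · exact Or.inr ⟨h', h⟩
  · rw [Set.disjoint_left]
    rintro ⟨a, b⟩ h h'
    exact H.asymm h.1 h'.1

lemma edgesBetween_le (H : Tournament V) (h2 : 2 ≤ Fintype.card V)
    (hP : ∀ y : ℝ, 0 < y → y < 1 → H.orderPoly y ≤ (Fintype.card V).factorial)
    (A B : Set V) (hAB : Disjoint A B) :
    (H.edgesBetween A B : ℝ)
      ≤ 1 / 2 * ((A.ncard : ℝ) * (B.ncard : ℝ)) + 2 * (Fintype.card V : ℝ) ^ (3 / 2 : ℝ) := by
  -- The class orders are rest, `A`, `B` here and `A`, `B`, rest in `h4`. On adding, edges between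
  -- `A ∪ B` and the rest cancel, and those between `A` and `B` count twice.
  have h3 := H.sum_colourSign_le h2 hP fun u => if u ∈ A then 1 else if u ∈ B then 2 else 0
  have h4 := H.sum_colourSign_le h2 hP fun u => if u ∈ A then 0 else if u ∈ B then 1 else 2
  have h5 := add_le_add h3 h4
  rw [← Finset.sum_add_distrib] at h5
  have h6 : (2 * ((H.edgesBetween A B : ℝ) - H.edgesBetween B A))
      ≤ 4 * (Fintype.card V : ℝ) ^ (3 / 2 : ℝ) + 4 * (Fintype.card V : ℝ) ^ (3 / 2 : ℝ) := by
    refine le_trans (le_of_eq ?_) h5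
    rw [edgesBetween_eq, edgesBetween_eq, ← Finset.sum_sub_distrib, Finset.mul_sum]
    refine Finset.sum_congr rfl fun e _ => ?_
    have hd : ∀ x, x ∈ A → x ∉ B := fun x hx => Set.disjoint_left.1 hAB hx
    by_cases ha : e.1 ∈ A <;> by_cases hb : e.2 ∈ A <;> by_cases ha' : e.1 ∈ B <;>
      by_cases hb' : e.2 ∈ B <;>
      first
        | exact absurd ha' (hd _ ha)
        | exact absurd hb' (hd _ hb)
        | (simp [ha, hb, ha', hb', colourSign]; try norm_num)
  have h7 : (H.edgesBetween A B : ℝ) + H.edgesBetween B A = A.ncard * B.ncard := by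
    exact_mod_cast H.edgesBetween_add_edgesBetween hAB
  linarith

end Consequences

/-! ### Derandomised rounding by an exponential potential -/

section Rounding

/-- Rounding one coordinate at a time, a family of multi-affine functions that is `1`-Lipschitz in
every coordinate has a vertex of the cube at which an exponential potential is small. -/
lemma exists_rounding {E F : Type*} [Fintype E] [DecidableEq E] [Fintype F]
    (Q : F → (E → ℝ) → ℝ) {p : ℝ} (hp0 : 0 ≤ p) (hp1 : p ≤ 1)
    {t : ℝ} (ht0 : 0 ≤ t) (ht1 : t ≤ 1)
    (haff : ∀ f x e r, Q f (Function.update x e r)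
      = (1 - r) * Q f (Function.update x e 0) + r * Q f (Function.update x e 1))
    (hlip : ∀ f x e, (∀ e, x e ∈ Set.Icc (0 : ℝ) 1) →
      |Q f (Function.update x e 1) - Q f (Function.update x e 0)| ≤ 1) :
    ∃ x : E → ℝ, (∀ e, x e = 0 ∨ x e = 1) ∧
      ∑ f, Real.exp (t * (Q f x - Q f fun _ => p))
        ≤ Fintype.card F * Real.exp (t ^ 2 * Fintype.card E) := by
  suffices h : ∀ S : Finset E, ∃ x : E → ℝ, (∀ e ∈ S, x e = 0 ∨ x e = 1) ∧ (∀ e ∉ S, x e = p) ∧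
      ∑ f, Real.exp (t * (Q f x - Q f fun _ => p))
        ≤ Fintype.card F * Real.exp (t ^ 2 * S.card) by
    obtain ⟨x, hx, -, hs⟩ := h Finset.univ
    exact ⟨x, fun e => hx e (Finset.mem_univ e), hs⟩
  intro S
  induction S using Finset.induction_on with
  | empty => exact ⟨fun _ => p, by simp, by simp, by simp⟩
  | insert a S ha ih =>
    obtain ⟨x, hx1, hx2, hx3⟩ := ih
    have hxa : Function.update x a p = x := by
      rw [← hx2 a ha, Function.update_eq_self]
    have hxI : ∀ e, x e ∈ Set.Icc (0 : ℝ) 1 := fun e => by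
      by_cases he : e ∈ S
      · rcases hx1 e he with h | h <;> rw [h] <;> norm_num
      · rw [hx2 e he]; exact ⟨hp0, hp1⟩
    -- Exponential moment of a centred two-valued variable: after `exp z ≤ 1 + z + z ^ 2` for `|z| ≤
    -- 1`, the linear terms cancel.
    have key : ∀ d : ℝ, |d| ≤ 1 →
        (1 - p) * Real.exp (t * (-p * d)) + p * Real.exp (t * ((1 - p) * d))
          ≤ Real.exp (t ^ 2) := by
      intro d hd
      have hquad : ∀ c : ℝ, |c| ≤ 1 → Real.exp (t * c) ≤ 1 + t * c + t ^ 2 := by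
        intro c hc
        have h1 : |t * c| ≤ 1 := by
          rw [abs_mul, abs_of_nonneg ht0]
          exact mul_le_one₀ ht1 (abs_nonneg c) hc
        have h2 := (abs_le.1 (Real.abs_exp_sub_one_sub_id_le h1)).2
        have h3 : (t * c) ^ 2 ≤ t ^ 2 := by
          rw [mul_pow]
          exact mul_le_of_le_one_right (sq_nonneg t) ((sq_le_one_iff_abs_le_one c).2 hc)
        linarith
      have h1 := hquad (-p * d) (by
        rw [abs_mul, abs_neg, abs_of_nonneg hp0]; exact mul_le_one₀ hp1 (abs_nonneg d) hd)
      have h2 := hquad ((1 - p) * d) (by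
        rw [abs_mul, abs_of_nonneg (by linarith : 0 ≤ 1 - p)]
        exact mul_le_one₀ (by linarith) (abs_nonneg d) hd)
      have h3 := Real.add_one_le_exp (t ^ 2)
      nlinarith [mul_le_mul_of_nonneg_left h1 (by linarith : 0 ≤ 1 - p),
        mul_le_mul_of_nonneg_left h2 hp0]
    set Φ : ℝ → ℝ := fun r =>
      ∑ f, Real.exp (t * (Q f (Function.update x a r) - Q f fun _ => p)) with hΦ
    have havg : (1 - p) * Φ 0 + p * Φ 1
        ≤ Fintype.card F * Real.exp (t ^ 2 * (insert a S).card) := by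
      calc (1 - p) * Φ 0 + p * Φ 1
          ≤ ∑ f, Real.exp (t * (Q f x - Q f fun _ => p)) * Real.exp (t ^ 2) := by
            simp only [hΦ, Finset.mul_sum, ← Finset.sum_add_distrib]
            refine Finset.sum_le_sum fun f _ => ?_
            have h1 := haff f x a p
            rw [hxa] at h1
            have h2 := key _ (hlip f x a hxI)
            have h3 : t * (Q f (Function.update x a 0) - Q f fun _ => p)
                = t * (Q f x - Q f fun _ => p) + t * (-p * (Q f (Function.update x a 1)
                  - Q f (Function.update x a 0))) := by rw [h1]; ring
            have h4 : t * (Q f (Function.update x a 1) - Q f fun _ => p)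
                = t * (Q f x - Q f fun _ => p) + t * ((1 - p) * (Q f (Function.update x a 1)
                  - Q f (Function.update x a 0))) := by rw [h1]; ring
            rw [h3, h4, Real.exp_add, Real.exp_add]
            have h5 := mul_le_mul_of_nonneg_left h2
              (Real.exp_pos (t * (Q f x - Q f fun _ => p))).le
            linarith
        _ ≤ _ := by
            rw [← Finset.sum_mul, Finset.card_insert_of_notMem ha]
            push_cast
            rw [mul_add, Real.exp_add, mul_one, ← mul_assoc]
            exact mul_le_mul_of_nonneg_right hx3 (Real.exp_pos _).le
    -- One of the two values does no worse than their weighted average.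
    have hgood : ∃ r : ℝ, (r = 0 ∨ r = 1) ∧
        Φ r ≤ Fintype.card F * Real.exp (t ^ 2 * (insert a S).card) := by
      by_contra! hc
      have h0 := hc 0 (Or.inl rfl)
      have h1 := hc 1 (Or.inr rfl)
      rcases hp0.eq_or_lt with hp | hp
      · subst hp; linarith
      · nlinarith
    obtain ⟨r, hr, hle⟩ := hgood
    refine ⟨Function.update x a r, ?_, ?_, hle⟩
    · intro e he
      by_cases hea : e = a
      · subst hea; simpa using hr
      · rw [Function.update_of_ne hea]
        exact hx1 e (Finset.mem_of_mem_insert_of_ne he hea)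
    · intro e he
      rw [Finset.mem_insert, not_or] at he
      rw [Function.update_of_ne he.1]
      exact hx2 e he.2

/-- Each single exponential is at most the whole potential; take logarithms and divide by `t`. -/
lemma exists_rounding_le {E F : Type*} [Fintype E] [DecidableEq E] [Fintype F]
    (Q : F → (E → ℝ) → ℝ) {p : ℝ} (hp0 : 0 ≤ p) (hp1 : p ≤ 1)
    {t : ℝ} (ht0 : 0 < t) (ht1 : t ≤ 1)
    (haff : ∀ f x e r, Q f (Function.update x e r)
      = (1 - r) * Q f (Function.update x e 0) + r * Q f (Function.update x e 1))
    (hlip : ∀ f x e, (∀ e, x e ∈ Set.Icc (0 : ℝ) 1) →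
      |Q f (Function.update x e 1) - Q f (Function.update x e 0)| ≤ 1) :
    ∃ x : E → ℝ, (∀ e, x e = 0 ∨ x e = 1) ∧
      ∀ f, Q f x - (Q f fun _ => p) ≤ Real.log (Fintype.card F) / t + t * Fintype.card E := by
  obtain ⟨x, hx, hs⟩ := exists_rounding Q hp0 hp1 ht0.le ht1 haff hlip
  refine ⟨x, hx, fun f => ?_⟩
  have h1 := (Finset.single_le_sum
    (fun f _ => (Real.exp_pos (t * (Q f x - Q f fun _ => p))).le) (Finset.mem_univ f)).trans hs
  have hF : (0 : ℝ) < Fintype.card F := by exact_mod_cast Fintype.card_pos_iff.2 ⟨f⟩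
  rw [← Real.exp_log hF, ← Real.exp_add, Real.exp_le_exp] at h1
  have h2 : Real.log (Fintype.card F) / t + t * Fintype.card E
      = (Real.log (Fintype.card F) + t ^ 2 * Fintype.card E) / t := by field_simp
  rw [h2, le_div_iff₀ ht0]
  linarith

lemma prod_affine {ι : Type*} (K : Finset ι) (g : ι → ℝ → ℝ)
    (hg : ∀ k ∈ K, ∀ r, g k r = (1 - r) * g k 0 + r * g k 1)
    (hu : ∀ k ∈ K, ∀ k' ∈ K, (∃ r, g k r ≠ g k 0) → (∃ r, g k' r ≠ g k' 0) → k = k') (r : ℝ) :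
    ∏ k ∈ K, g k r = (1 - r) * ∏ k ∈ K, g k 0 + r * ∏ k ∈ K, g k 1 := by
  by_cases h : ∃ k ∈ K, ∃ r, g k r ≠ g k 0
  · obtain ⟨k, hk, hkr⟩ := h
    have hc : ∀ r, ∏ k' ∈ K.erase k, g k' r = ∏ k' ∈ K.erase k, g k' 0 := by
      refine fun r => Finset.prod_congr rfl fun k' hk' => ?_
      by_contra hne
      exact (Finset.mem_erase.1 hk').1
        (hu k' (Finset.mem_of_mem_erase hk') k hk ⟨r, hne⟩ hkr)
    rw [← Finset.mul_prod_erase K (g · r) hk, ← Finset.mul_prod_erase K (g · 0) hk,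
      ← Finset.mul_prod_erase K (g · 1) hk, hc r, hc 1, hg k hk r]
    ring
  · push Not at h
    rw [Finset.prod_congr rfl fun k hk => h k hk r, Finset.prod_congr rfl fun k hk => h k hk 1]
    ring

end Rounding

/-! ### Fractional tournaments and weighted counts of copies -/

section Fractional

/-- The weight of the pair `(i, j)` in the fractional tournament with upper triangle `x`. -/
noncomputable def pairWeight {n : ℕ} (x : Fin n × Fin n → ℝ) (i j : Fin n) : ℝ :=
  if i < j then x (i, j) else if j < i then 1 - x (j, i) else 0

variable {n : ℕ}

lemma pairWeight_mem_Icc {x : Fin n × Fin n → ℝ} (hx : ∀ e, x e ∈ Set.Icc (0 : ℝ) 1)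
    (i j : Fin n) : pairWeight x i j ∈ Set.Icc (0 : ℝ) 1 := by
  have h1 := hx (i, j)
  have h2 := hx (j, i)
  simp only [Set.mem_Icc] at *
  unfold pairWeight
  split_ifs
  · exact h1
  · constructor <;> linarith
  · norm_num

lemma pairWeight_update_of_ne (x : Fin n × Fin n → ℝ) {e : Fin n × Fin n} {i j : Fin n}
    (h1 : (i, j) ≠ e) (h2 : (j, i) ≠ e) (r : ℝ) :
    pairWeight (Function.update x e r) i j = pairWeight x i j := by
  unfold pairWeight
  rw [Function.update_of_ne h1, Function.update_of_ne h2]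

lemma pairWeight_update_affine (x : Fin n × Fin n → ℝ) (e : Fin n × Fin n) (i j : Fin n) (r : ℝ) :
    pairWeight (Function.update x e r) i j
      = (1 - r) * pairWeight (Function.update x e 0) i j
        + r * pairWeight (Function.update x e 1) i j := by
  unfold pairWeight
  by_cases h1 : (i, j) = e <;> by_cases h2 : (j, i) = e <;>
    simp only [Function.update_apply, h1, h2, if_true, if_false] <;> split_ifs <;> ring

lemma coe_injective {V : Type*} (U : Set (Fin n)) (φ : V ↪ U) :
    Function.Injective fun v => (φ v : Fin n) :=
  Subtype.val_injective.comp φ.injective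

variable {V : Type*} [Fintype V]

/-- The weight of the map `φ` as a copy of `H`. -/
noncomputable def copyWeight (H : Tournament V) (x : Fin n × Fin n → ℝ) (φ : V → Fin n) : ℝ :=
  ∏ e ∈ H.edges, pairWeight x (φ e.1) (φ e.2)

lemma copyWeight_mem_Icc (H : Tournament V) {x : Fin n × Fin n → ℝ}
    (hx : ∀ e, x e ∈ Set.Icc (0 : ℝ) 1) (φ : V → Fin n) :
    H.copyWeight x φ ∈ Set.Icc (0 : ℝ) 1 :=
  ⟨Finset.prod_nonneg fun _ _ => (pairWeight_mem_Icc hx _ _).1,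
    Finset.prod_le_one (fun _ _ => (pairWeight_mem_Icc hx _ _).1)
      fun _ _ => (pairWeight_mem_Icc hx _ _).2⟩

/-- An injective map sends at most one edge of `H` onto the pair `e`, in either direction, since `H`
has no antiparallel edges. Hence at most one factor varies. -/
lemma copyWeight_update_affine (H : Tournament V) (x : Fin n × Fin n → ℝ) (e : Fin n × Fin n)
    {φ : V → Fin n} (hφ : Function.Injective φ) (r : ℝ) :
    H.copyWeight (Function.update x e r) φ
      = (1 - r) * H.copyWeight (Function.update x e 0) φ
        + r * H.copyWeight (Function.update x e 1) φ := by
  have hne : ∀ k : V × V,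
      (∃ r, pairWeight (Function.update x e r) (φ k.1) (φ k.2)
        ≠ pairWeight (Function.update x e 0) (φ k.1) (φ k.2)) →
      (φ k.1, φ k.2) = e ∨ (φ k.2, φ k.1) = e := by
    rintro k ⟨r, hr⟩
    by_contra! hc
    exact hr (by rw [pairWeight_update_of_ne x hc.1 hc.2, pairWeight_update_of_ne x hc.1 hc.2])
  refine prod_affine H.edges
    (fun k r => pairWeight (Function.update x e r) (φ k.1) (φ k.2))
    (fun k _ r => pairWeight_update_affine x e _ _ r) ?_ r
  rintro ⟨u, v⟩ hk ⟨u', v'⟩ hk' h h'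
  rw [mem_edges] at hk hk'
  rcases hne _ h with h | h <;> rcases hne _ h' with h' | h' <;>
    have h'' := h.trans h'.symm <;> simp only [Prod.mk.injEq] at h'' <;>
    obtain ⟨h1, h2⟩ := h'' <;> have h1 := hφ h1 <;> have h2 := hφ h2 <;> subst h1 <;> subst h2
  · rfl
  · exact absurd hk (H.asymm hk')
  · exact absurd hk (H.asymm hk')
  · rfl

/-- The fractional number of copies of `H` inside `U`. -/
noncomputable def copySum (H : Tournament V) (U : Set (Fin n)) (x : Fin n × Fin n → ℝ) : ℝ :=
  ∑ φ : V ↪ U, H.copyWeight x fun v => φ v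

lemma copySum_update_affine (H : Tournament V) (U : Set (Fin n)) (x : Fin n × Fin n → ℝ)
    (e : Fin n × Fin n) (r : ℝ) :
    H.copySum U (Function.update x e r) = (1 - r) * H.copySum U (Function.update x e 0)
      + r * H.copySum U (Function.update x e 1) := by
  unfold copySum
  rw [Finset.mul_sum, Finset.mul_sum, ← Finset.sum_add_distrib]
  exact Finset.sum_congr rfl fun φ _ => H.copyWeight_update_affine x e (coe_injective U φ) r

/-- Overwriting the prescribed values at `u` and `v` by arbitrary ones injects these embeddings,
together with a pair of new values, into all maps. -/
lemma card_embeddings_through_le (U : Set (Fin n)) {u v : V} (huv : u ≠ v) (i j : Fin n) :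
    (Finset.univ.filter fun φ : V ↪ U => (φ u : Fin n) = i ∧ (φ v : Fin n) = j).card * n ^ 2
      ≤ n ^ Fintype.card V := by
  have h1 : n ^ Fintype.card V = Fintype.card (V → Fin n) := by simp
  have h2 : n ^ 2 = Fintype.card (Fin n × Fin n) := by simp [sq]
  rw [h1, h2, ← Fintype.card_coe, ← Fintype.card_prod]
  refine Fintype.card_le_of_injective
    (fun q => Function.update (Function.update (fun w => (q.1.1 w : Fin n)) u q.2.1) v q.2.2) ?_
  rintro ⟨⟨φ, hφ⟩, a, b⟩ ⟨⟨ψ, hψ⟩, a', b'⟩ h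
  simp only [Finset.mem_filter, Finset.mem_univ, true_and] at hφ hψ h
  have hb : b = b' := by simpa using congrFun h v
  have ha : a = a' := by simpa [huv] using congrFun h u
  have hφψ : φ = ψ := by
    ext w
    by_cases hwv : w = v
    · rw [hwv, hφ.2, hψ.2]
    by_cases hwu : w = u
    · rw [hwu, hφ.1, hψ.1]
    have := congrFun h w
    simp only [Function.update_of_ne hwv, Function.update_of_ne hwu] at this
    rw [this]
  subst hb ha hφψ
  rfl

/-- Only embeddings that send an edge of `H` onto the pair `e` are affected. There are at most `h ^
2` choices of an edge and a direction, each met by at most `n ^ (h - 2)` embeddings. -/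
lemma abs_copySum_update_sub_le (H : Tournament V) (hn : 0 < n) (U : Set (Fin n))
    {x : Fin n × Fin n → ℝ} (hx : ∀ e, x e ∈ Set.Icc (0 : ℝ) 1) (e : Fin n × Fin n) :
    |H.copySum U (Function.update x e 1) - H.copySum U (Function.update x e 0)|
      ≤ (Fintype.card V : ℝ) ^ 2 * (n : ℝ) ^ Fintype.card V / (n : ℝ) ^ 2 := by
  have hupd : ∀ r ∈ Set.Icc (0 : ℝ) 1, ∀ e', Function.update x e r e' ∈ Set.Icc (0 : ℝ) 1 := by
    intro r hr e'
    rw [Function.update_apply]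
    split_ifs
    · exact hr
    · exact hx e'
  have hn' : (0 : ℝ) < (n : ℝ) ^ 2 := by positivity
  have hthrough : ∀ u v : V, u ≠ v → ∀ i j : Fin n,
      ∑ φ : V ↪ U, (if (φ u : Fin n) = i ∧ (φ v : Fin n) = j then (1 : ℝ) else 0)
        ≤ (n : ℝ) ^ Fintype.card V / (n : ℝ) ^ 2 := by
    intro u v huv i j
    rw [le_div_iff₀ hn', Finset.sum_boole]
    exact_mod_cast card_embeddings_through_le U huv i j
  calc |H.copySum U (Function.update x e 1) - H.copySum U (Function.update x e 0)|
      ≤ ∑ φ : V ↪ U, |H.copyWeight (Function.update x e 1) (fun v => φ v)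
          - H.copyWeight (Function.update x e 0) (fun v => φ v)| := by
        unfold copySum
        rw [← Finset.sum_sub_distrib]
        exact Finset.abs_sum_le_sum_abs _ _
    _ ≤ ∑ φ : V ↪ U, ∑ k ∈ H.edges,
          ((if (φ k.1 : Fin n) = e.1 ∧ (φ k.2 : Fin n) = e.2 then (1 : ℝ) else 0)
            + if (φ k.2 : Fin n) = e.1 ∧ (φ k.1 : Fin n) = e.2 then (1 : ℝ) else 0) := by
        refine Finset.sum_le_sum fun φ _ => ?_
        have hnn : ∀ k ∈ H.edges,
            0 ≤ ((if (φ k.1 : Fin n) = e.1 ∧ (φ k.2 : Fin n) = e.2 then (1 : ℝ) else 0)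
            + if (φ k.2 : Fin n) = e.1 ∧ (φ k.1 : Fin n) = e.2 then (1 : ℝ) else 0) := by
          intro k _
          positivity
        by_cases hk : ∃ k ∈ H.edges, ((φ k.1 : Fin n) = e.1 ∧ (φ k.2 : Fin n) = e.2) ∨
            ((φ k.2 : Fin n) = e.1 ∧ (φ k.1 : Fin n) = e.2)
        · obtain ⟨k, hkH, hk⟩ := hk
          have h1 := H.copyWeight_mem_Icc (hupd 1 (by norm_num)) (fun v => φ v)
          have h0 := H.copyWeight_mem_Icc (hupd 0 (by norm_num)) (fun v => φ v)
          have h2 : |H.copyWeight (Function.update x e 1) (fun v => φ v)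
              - H.copyWeight (Function.update x e 0) (fun v => φ v)| ≤ 1 := by
            rw [abs_le]
            constructor <;> linarith [h1.1, h1.2, h0.1, h0.2]
          refine h2.trans (le_trans ?_ (Finset.single_le_sum hnn hkH))
          rcases hk with hk | hk <;> rw [if_pos hk]
          · exact le_add_of_nonneg_right (by positivity)
          · exact le_add_of_nonneg_left (by positivity)
        · push Not at hk
          have h0 : H.copyWeight (Function.update x e 1) (fun v => φ v)
              = H.copyWeight (Function.update x e 0) (fun v => φ v) := by
            refine Finset.prod_congr rfl fun k hkH => ?_
            have h1 : ((φ k.1 : Fin n), (φ k.2 : Fin n)) ≠ e := fun h => by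
              subst h; exact (hk k hkH).1 rfl rfl
            have h2 : ((φ k.2 : Fin n), (φ k.1 : Fin n)) ≠ e := fun h => by
              subst h; exact (hk k hkH).2 rfl rfl
            rw [pairWeight_update_of_ne x h1 h2, pairWeight_update_of_ne x h1 h2]
          rw [h0, sub_self, abs_zero]
          exact Finset.sum_nonneg hnn
    _ ≤ ∑ k ∈ H.edges, 2 * ((n : ℝ) ^ Fintype.card V / (n : ℝ) ^ 2) := by
        rw [Finset.sum_comm]
        refine Finset.sum_le_sum fun k hk => ?_
        have hne := H.ne_of_mem ((H.mem_edges k).1 hk)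
        rw [Finset.sum_add_distrib, two_mul]
        exact add_le_add (hthrough _ _ hne _ _) (hthrough _ _ hne.symm _ _)
    _ ≤ _ := by
        rw [Finset.sum_const, nsmul_eq_mul, ← mul_assoc, mul_comm _ (2 : ℝ), mul_div_assoc]
        exact mul_le_mul_of_nonneg_right H.two_mul_card_edges_le_sq (by positivity)

lemma sum_perm_eq_orderPoly (H : Tournament V) {α : Type*} [LinearOrder α] {a : V → α}
    (ha : Function.Injective a) (y : ℝ) :
    ∑ π : Equiv.Perm V, ∏ e ∈ H.edges, (1 + y * osign (a (π e.1)) (a (π e.2)))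
      = H.orderPoly y := by
  obtain ⟨σ, hσ⟩ := exists_ordering a ha
  refine Fintype.sum_equiv ((Equiv.refl V).equivCongr σ) _ _ fun π => ?_
  refine Finset.prod_congr rfl fun e _ => ?_
  have : osign (a (π e.1)) (a (π e.2)) = osign (σ (π e.1)) (σ (π e.2)) := by
    unfold osign
    simp only [hσ]
  rw [this]
  rfl

/-- The expected number of copies of `H` in `U` when every pair is forward with probability
`(1 + y) / 2`. -/
lemma factorial_mul_copySum_const (H : Tournament V) (U : Set (Fin n)) (y : ℝ) :
    (Fintype.card V).factorial * H.copySum U (fun _ => (1 + y) / 2)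
      = (U.ncard.descFactorial (Fintype.card V) : ℝ)
        * ((1 / 2) ^ (Fintype.card V).choose 2 * H.orderPoly y) := by
  have hw : ∀ φ : V → Fin n, Function.Injective φ → H.copyWeight (fun _ => (1 + y) / 2) φ
      = (1 / 2) ^ (Fintype.card V).choose 2
        * ∏ e ∈ H.edges, (1 + y * osign (φ e.1) (φ e.2)) := by
    intro φ hφ
    rw [← H.card_edges, ← Finset.prod_const, ← Finset.prod_mul_distrib]
    refine Finset.prod_congr rfl fun e he => ?_
    rcases lt_or_gt_of_ne (hφ.ne (H.ne_of_mem ((H.mem_edges e).1 he))) with h | h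
    · rw [osign_of_lt h, pairWeight, if_pos h]; ring
    · rw [osign_of_gt h, pairWeight, if_neg h.not_gt, if_pos h]; ring
  -- Precomposition with `π` permutes the embeddings; averaging over `π` then turns each embedding's
  -- contribution into the full sum over orderings.
  have hperm : ∀ π : Equiv.Perm V, H.copySum U (fun _ => (1 + y) / 2)
      = ∑ φ : V ↪ U, H.copyWeight (fun _ => (1 + y) / 2) fun v => (φ (π v) : Fin n) := by
    intro π
    refine (Fintype.sum_equiv ⟨fun φ => π.toEmbedding.trans φ, fun φ => π.symm.toEmbedding.trans φ,
      fun φ => ?_, fun φ => ?_⟩ _ _ fun φ => rfl).symm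
    · ext; simp
    · ext; simp
  have hcard : Fintype.card (V ↪ U) = U.ncard.descFactorial (Fintype.card V) := by
    rw [Fintype.card_embedding_eq, ← Nat.card_eq_fintype_card (α := U), Nat.card_coe_set_eq]
  calc (Fintype.card V).factorial * H.copySum U (fun _ => (1 + y) / 2)
      = ∑ π : Equiv.Perm V, H.copySum U (fun _ => (1 + y) / 2) := by
        rw [Finset.sum_const, Finset.card_univ, Fintype.card_perm, nsmul_eq_mul]
    _ = ∑ φ : V ↪ U, ∑ π : Equiv.Perm V,
          H.copyWeight (fun _ => (1 + y) / 2) fun v => (φ (π v) : Fin n) := by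
        rw [Finset.sum_comm]
        exact Finset.sum_congr rfl fun π _ => hperm π
    _ = ∑ φ : V ↪ U, (1 / 2) ^ (Fintype.card V).choose 2 * H.orderPoly y := by
        refine Finset.sum_congr rfl fun φ _ => ?_
        rw [← H.sum_perm_eq_orderPoly (coe_injective U φ), Finset.mul_sum]
        exact Finset.sum_congr rfl fun π _ => hw _ ((coe_injective U φ).comp π.injective)
    _ = _ := by rw [Finset.sum_const, Finset.card_univ, hcard, nsmul_eq_mul]

/-- The tournament on `Fin n` with a given upper triangle. -/
noncomputable def ofUpperTriangle (x : Fin n × Fin n → ℝ) (hx : ∀ e, x e = 0 ∨ x e = 1) :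
    Tournament (Fin n) where
  E := {e | pairWeight x e.1 e.2 = 1}
  irrefl u := by simp [pairWeight]
  exactly_one u v huv := by
    rcases lt_or_gt_of_ne huv with h | h
    · rcases hx (u, v) with h' | h' <;> simp [pairWeight, h, h.not_gt, h', Xor]
    · rcases hx (v, u) with h' | h' <;> simp [pairWeight, h, h.not_gt, h', Xor]

lemma mem_ofUpperTriangle {x : Fin n × Fin n → ℝ} {hx : ∀ e, x e = 0 ∨ x e = 1} {i j : Fin n} :
    (i, j) ∈ (ofUpperTriangle x hx).E ↔ pairWeight x i j = 1 := Iff.rfl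

/-- With weights `0` and `1`, an embedding has weight `1` exactly when it preserves edges. Between
tournaments an injective edge-preserving map also reflects edges, and every labelled embedding is
injective. -/
lemma localEmbCount_ofUpperTriangle (H : Tournament V) (x : Fin n × Fin n → ℝ)
    (hx : ∀ e, x e = 0 ∨ x e = 1) (U : Set (Fin n)) :
    (H.localEmbCount (ofUpperTriangle x hx) U : ℝ) = H.copySum U x := by
  set T := ofUpperTriangle x hx with hT
  have hinj : ∀ φ : V → U, IsLabelledEmbedding H (T.induce U) φ → Function.Injective φ := by
    intro φ hφ u v huv
    by_contra hne
    rcases H.mem_or_mem hne with h | h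
    · have := (hφ _ _).1 h
      rw [huv] at this
      exact (T.induce U).irrefl _ this
    · have := (hφ _ _).1 h
      rw [huv] at this
      exact (T.induce U).irrefl _ this
  have hset : {φ : V → U | IsLabelledEmbedding H (T.induce U) φ}
      = (fun φ : V ↪ U => (φ : V → U)) ''
        ↑(Finset.univ.filter fun φ : V ↪ U => IsLabelledEmbedding H (T.induce U) φ) := by
    ext φ
    simp only [Set.mem_ofPred_eq, Set.mem_image, Finset.coe_filter, Finset.mem_univ, true_and]
    constructor
    · exact fun h => ⟨⟨φ, hinj φ h⟩, h, rfl⟩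
    · rintro ⟨ψ, h, rfl⟩
      exact h
  rw [localEmbCount, embCount, hset, Set.ncard_image_of_injective _ DFunLike.coe_injective,
    Set.ncard_coe_finset, ← Finset.sum_boole, copySum]
  refine Finset.sum_congr rfl fun φ _ => ?_
  have h01 : ∀ i j, pairWeight x i j = 0 ∨ pairWeight x i j = 1 := by
    intro i j
    unfold pairWeight
    split_ifs
    · exact hx _
    · rcases hx (j, i) with h | h <;> simp [h]
    · exact Or.inl rfl
  by_cases hφ : IsLabelledEmbedding H (T.induce U) φ
  · rw [if_pos hφ, copyWeight, Finset.prod_eq_one]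
    intro e he
    exact (hφ e.1 e.2).1 ((H.mem_edges e).1 he)
  · rw [if_neg hφ, copyWeight, eq_comm]
    by_contra hne
    apply hφ
    have hall : ∀ u v, (u, v) ∈ H.E → (φ u, φ v) ∈ (T.induce U).E := by
      intro u v huv
      refine (h01 _ _).resolve_left fun h0 => hne ?_
      exact Finset.prod_eq_zero ((H.mem_edges (u, v)).2 huv) h0
    intro u v
    refine ⟨hall u v, fun h => ?_⟩
    have huv : u ≠ v := fun h' => (T.induce U).ne_of_mem h (by rw [h'])
    exact (H.mem_or_mem huv).resolve_right fun h' => (T.induce U).asymm h (hall v u h')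

/-- The total weight of the upper triangle. -/
noncomputable def upperSum (x : Fin n × Fin n → ℝ) : ℝ :=
  ∑ e : Fin n × Fin n, if e.1 < e.2 then x e else 0

lemma upperSum_update (x : Fin n × Fin n → ℝ) (e : Fin n × Fin n) (r : ℝ) :
    upperSum (Function.update x e r)
      = upperSum (Function.update x e 0) + r * if e.1 < e.2 then 1 else 0 := by
  have : r * (if e.1 < e.2 then (1 : ℝ) else 0)
      = ∑ e' : Fin n × Fin n, if e' = e then r * (if e.1 < e.2 then (1 : ℝ) else 0) else 0 := by
    simp
  rw [this, upperSum, upperSum, ← Finset.sum_add_distrib]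
  refine Finset.sum_congr rfl fun e' _ => ?_
  by_cases h : e' = e
  · subst h; simp
  · simp [h]

lemma upperSum_const (p : ℝ) : upperSum (fun _ : Fin n × Fin n => p) = p * (n.choose 2 : ℝ) := by
  have h : ∀ n : ℕ, ∑ i : Fin n, ∑ j : Fin n, (if i < j then (1 : ℝ) else 0) = n.choose 2 := by
    intro n
    induction n with
    | zero => simp
    | succ n ih =>
      rw [Fin.sum_univ_succ]
      simp only [Fin.sum_univ_succ (n := n), Fin.succ_lt_succ_iff, Fin.succ_pos, Fin.not_lt_zero,
        if_true, if_false, zero_add, lt_irrefl, ih]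
      rw [Nat.choose_succ_succ']
      simp
  rw [upperSum, ← h, Fintype.sum_prod_type, Finset.mul_sum]
  refine Finset.sum_congr rfl fun i _ => ?_
  rw [Finset.mul_sum]
  exact Finset.sum_congr rfl fun j _ => by simp

lemma ncard_forwardEdges_ofUpperTriangle (x : Fin n × Fin n → ℝ)
    (hx : ∀ e, x e = 0 ∨ x e = 1) {m : ℕ} (hm : n = m) :
    (((ofUpperTriangle x hx).forwardEdges (finCongr hm)).ncard : ℝ) = upperSum x := by
  have h1 : (ofUpperTriangle x hx).forwardEdges (finCongr hm)
      = ↑(Finset.univ.filter fun e : Fin n × Fin n => e.1 < e.2 ∧ x e = 1) := by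
    subst hm
    ext ⟨i, j⟩
    simp only [forwardEdges, mem_ofUpperTriangle, Set.mem_ofPred_eq, Finset.coe_filter,
      Finset.mem_univ, true_and, finCongr_refl, Equiv.refl_apply, pairWeight]
    constructor
    · rintro ⟨h, hij⟩
      rw [if_pos hij] at h
      exact ⟨hij, h⟩
    · rintro ⟨hij, h⟩
      rw [if_pos hij]
      exact ⟨h, hij⟩
  rw [h1, Set.ncard_coe_finset, ← Finset.sum_boole, upperSum]
  refine Finset.sum_congr rfl fun e _ => ?_
  rcases hx e with h | h <;> simp [h]

end Fractional

/-! ### Biased tournaments as counterexamples to local forcing -/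

section NotLocallyForcing

/-- Non-injective maps are of lower order; the factor `n` on the left avoids the exponent `k - 1`.
-/
lemma pow_sub_descFactorial_le {m n : ℕ} (hmn : m ≤ n) (k : ℕ) :
    (n : ℝ) * ((m : ℝ) ^ k - m.descFactorial k) ≤ (k : ℝ) ^ 2 * (n : ℝ) ^ k := by
  have hmn' : (m : ℝ) ≤ n := by exact_mod_cast hmn
  have hm0 : (0 : ℝ) ≤ m := Nat.cast_nonneg _
  induction k with
  | zero => simp
  | succ k ih =>
    have h1 : ((m : ℝ) - k) ≤ ((m - k : ℕ) : ℝ) := by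
      rw [sub_le_iff_le_add]; exact_mod_cast (by omega : m ≤ m - k + k)
    have h2 : (m.descFactorial k : ℝ) ≤ (n : ℝ) ^ k :=
      (by exact_mod_cast Nat.descFactorial_le_pow m k : (m.descFactorial k : ℝ) ≤ (m : ℝ) ^ k).trans
        (by gcongr)
    have h3 : (0 : ℝ) ≤ m.descFactorial k := Nat.cast_nonneg _
    rw [Nat.descFactorial_succ]
    push_cast
    have h4 := mul_le_mul_of_nonneg_right h1 h3
    have h5 : (0 : ℝ) ≤ (m : ℝ) ^ k - m.descFactorial k := by
      rw [sub_nonneg]; exact_mod_cast Nat.descFactorial_le_pow m k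
    have h6 : (0 : ℝ) ≤ (k : ℝ) := Nat.cast_nonneg _
    have h7 : (0 : ℝ) ≤ (n : ℝ) ^ k := by positivity
    have h8 : (0 : ℝ) ≤ (n : ℝ) := Nat.cast_nonneg _
    calc (n : ℝ) * ((m : ℝ) ^ (k + 1) - ((m - k : ℕ) : ℝ) * m.descFactorial k)
        ≤ n * ((m : ℝ) * ((m : ℝ) ^ k - m.descFactorial k) + k * m.descFactorial k) := by
          refine mul_le_mul_of_nonneg_left ?_ h8
          rw [pow_succ]; linarith
      _ = m * (n * ((m : ℝ) ^ k - m.descFactorial k)) + n * (k * m.descFactorial k) := by ring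
      _ ≤ n * ((k : ℝ) ^ 2 * (n : ℝ) ^ k) + n * (k * (n : ℝ) ^ k) := by gcongr
      _ ≤ ((k : ℝ) + 1) ^ 2 * (n : ℝ) ^ (k + 1) := by
          rw [pow_succ (n : ℝ)]
          nlinarith [mul_nonneg h8 h7, mul_nonneg h6 (mul_nonneg h8 h7)]

variable {V : Type*} [Fintype V]

/-- There are tournaments in which all local counts of `H` and the number of forward edges are
close to those of the random tournament whose pairs are forward with probability `p`. -/
lemma exists_tournament_near_random (H : Tournament V) (h2 : 2 ≤ Fintype.card V) {p : ℝ}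
    (hp0 : 0 ≤ p) (hp1 : p ≤ 1) {η : ℝ} (hη0 : 0 < η) (hη1 : η ≤ 1) {n : ℕ} (hn2 : 2 ≤ n)
    (hn : 8 / η ^ 2 ≤ n) :
    ∃ (x : Fin n × Fin n → ℝ) (_ : ∀ e, x e = 0 ∨ x e = 1),
      (∀ U, |H.copySum U x - H.copySum U fun _ => p|
        ≤ η * (Fintype.card V : ℝ) ^ 2 * (n : ℝ) ^ Fintype.card V) ∧
      p * (n.choose 2 : ℝ) - η * (n : ℝ) ^ 2 ≤ upperSum x := by
  have hn0 : (0 : ℝ) < n := by exact_mod_cast (by omega : 0 < n)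
  have hk0 : (0 : ℝ) < Fintype.card V := by exact_mod_cast (by omega : 0 < Fintype.card V)
  set L : ℝ := (Fintype.card V : ℝ) ^ 2 * (n : ℝ) ^ Fintype.card V / (n : ℝ) ^ 2 with hL
  have hL0 : 0 < L := by positivity
  -- The signs give two-sided control of each count, and dividing by `L` makes it `1`-Lipschitz. For
  -- the forward edges only a lower bound is needed.
  let Q : Option (Bool × Set (Fin n)) → (Fin n × Fin n → ℝ) → ℝ := fun f x =>
    match f with
    | none => -upperSum x
    | some (b, U) => (if b then 1 else -1) * (H.copySum U x / L)
  -- With `t = η / 2` the term `t * n ^ 2` uses half of the allowed error; the logarithmic term fits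
  -- into the other half because `n + 2 ≤ 2 * n ≤ (η / 2) ^ 2 * n ^ 2`.
  obtain ⟨x, hx, hQ⟩ := exists_rounding_le Q hp0 hp1 (half_pos hη0) (by linarith) (by
      rintro (_ | ⟨b, U⟩) x e r
      · simp only [Q]
        rw [upperSum_update x e r, upperSum_update x e 1]
        ring
      · simp only [Q]
        rw [copySum_update_affine H U x e r]
        ring) (by
      rintro (_ | ⟨b, U⟩) x e hxI
      · simp only [Q]
        rw [upperSum_update x e 1]
        split_ifs <;> norm_num
      · simp only [Q]
        have h := H.abs_copySum_update_sub_le (by omega) U hxI e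
        rw [← mul_sub, ← sub_div, abs_mul, abs_div, abs_of_pos hL0]
        have hs : |if b = true then (1 : ℝ) else -1| = 1 := by split_ifs <;> norm_num
        rw [hs, one_mul, div_le_one hL0]
        exact h)
  have hcard : Real.log (Fintype.card (Option (Bool × Set (Fin n)))) ≤ n + 2 := by
    have h1 : Fintype.card (Option (Bool × Set (Fin n))) ≤ 2 ^ (n + 2) := by
      simp only [Fintype.card_option, Fintype.card_prod, Fintype.card_bool, Fintype.card_set,
        Fintype.card_fin]
      have := Nat.one_le_two_pow (n := n)
      rw [pow_add]
      omega
    have h3 : (0 : ℝ) < Fintype.card (Option (Bool × Set (Fin n))) := by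
      exact_mod_cast Fintype.card_pos
    have h4 : (Fintype.card (Option (Bool × Set (Fin n))) : ℝ) ≤ 2 ^ (n + 2) := by
      exact_mod_cast h1
    have h5 := Real.log_le_log h3 h4
    rw [Real.log_pow] at h5
    push_cast at h5
    have := Real.log_two_lt_d9
    nlinarith
  have hdev : Real.log (Fintype.card (Option (Bool × Set (Fin n)))) / (η / 2)
      + η / 2 * Fintype.card (Fin n × Fin n) ≤ η * (n : ℝ) ^ 2 := by
    have h1 : Real.log (Fintype.card (Option (Bool × Set (Fin n)))) / (η / 2)
        ≤ η / 2 * (n : ℝ) ^ 2 := by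
      rw [div_le_iff₀ (half_pos hη0)]
      rw [div_le_iff₀ (by positivity)] at hn
      have : (2 : ℝ) ≤ n := by exact_mod_cast hn2
      nlinarith
    rw [Fintype.card_prod, Fintype.card_fin]
    push_cast
    nlinarith
  have hQ' := fun f => (hQ f).trans hdev
  refine ⟨x, hx, fun U => ?_, ?_⟩
  · have h1 := hQ' (some (true, U))
    have h3 := hQ' (some (false, U))
    simp only [Q, if_true, Bool.false_eq_true, if_false, one_mul, neg_mul] at h1 h3
    have h4 : |H.copySum U x / L - H.copySum U (fun _ => p) / L| ≤ η * (n : ℝ) ^ 2 := by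
      rw [abs_le]
      constructor <;> linarith
    rw [← sub_div, abs_div, abs_of_pos hL0, div_le_iff₀ hL0] at h4
    refine h4.trans (le_of_eq ?_)
    rw [hL]
    field_simp
  · have h1 := hQ' none
    simp only [Q] at h1
    rw [upperSum_const] at h1
    linarith

/-- If `orderPoly H` has the random value at some `y ∈ (0, 1)`, then the random tournament in which
every pair is forward with probability `(1 + y) / 2` has the right local counts of `H`. -/
lemma IsLocallyForcing.orderPoly_ne {H : Tournament V} (hlf : H.IsLocallyForcing)
    (h2 : 2 ≤ Fintype.card V) {y : ℝ} (hy0 : 0 < y) (hy1 : y < 1) :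
    H.orderPoly y ≠ (Fintype.card V).factorial := by
  intro hy
  -- The excess of forward edges is `y / 2 * (n choose 2) ≥ y * n ^ 2 / 8`. Losing `y * n ^ 2 / 32`
  -- to rounding still leaves more than `y * n ^ 2 / 16`.
  obtain ⟨δ, hδ, n₀, hforce⟩ := hlf (y / 16) (by positivity)
  set k : ℝ := (Fintype.card V : ℝ) with hk
  have hk0 : 0 < k := by rw [hk]; exact_mod_cast (by omega : 0 < Fintype.card V)
  -- Half of `δ` pays for the rounding; the other half pays for the non-injective maps, through
  -- `n₂`.
  set η := min (min 1 (δ / (2 * k ^ 2))) (y / 32) with hη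
  have hη0 : 0 < η := by positivity
  have hη1 : η ≤ 1 := (min_le_left _ _).trans (min_le_left _ _)
  have hη2 : η * k ^ 2 ≤ δ / 2 := by
    have : η ≤ δ / (2 * k ^ 2) := (min_le_left _ _).trans (min_le_right _ _)
    rw [le_div_iff₀ (by positivity)] at this
    linarith
  have hη3 : η ≤ y / 32 := min_le_right _ _
  obtain ⟨n₁, hn₁⟩ := exists_nat_ge (8 / η ^ 2)
  obtain ⟨n₂, hn₂⟩ := exists_nat_ge (2 * k ^ 2 / δ)
  set n := n₀ + n₁ + n₂ + 2 with hn
  have hn2 : 2 ≤ n := by omega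
  have hn0 : (0 : ℝ) < n := by exact_mod_cast (by omega : 0 < n)
  have hn₁' : 8 / η ^ 2 ≤ n := hn₁.trans (by exact_mod_cast (by omega : n₁ ≤ n))
  have hn₂' : 2 * k ^ 2 / δ ≤ n := hn₂.trans (by exact_mod_cast (by omega : n₂ ≤ n))
  obtain ⟨x, hx, hcount, hup⟩ := H.exists_tournament_near_random h2 (p := (1 + y) / 2)
    (by linarith) (by linarith) hη0 hη1 hn2 hn₁'
  have hloc : LocalCountsWithin H (ofUpperTriangle x hx) δ := by
    intro U
    rw [Fintype.card_fin, localEmbCount_ofUpperTriangle]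
    have h1 := H.factorial_mul_copySum_const U y
    rw [hy] at h1
    have hfac : ((Fintype.card V).factorial : ℝ) ≠ 0 := by
      exact_mod_cast Nat.factorial_ne_zero _
    have h3 : H.copySum U (fun _ => (1 + y) / 2)
        = (1 / 2) ^ (Fintype.card V).choose 2 * (U.ncard.descFactorial (Fintype.card V) : ℝ) := by
      apply mul_left_cancel₀ hfac
      rw [h1]; ring
    have hUn : U.ncard ≤ n := by
      have := Set.ncard_le_card U
      simpa using this
    have h4 := pow_sub_descFactorial_le hUn (Fintype.card V)
    have h5 : (0 : ℝ) ≤ (U.ncard : ℝ) ^ Fintype.card V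
        - U.ncard.descFactorial (Fintype.card V) := by
      rw [sub_nonneg]; exact_mod_cast Nat.descFactorial_le_pow _ _
    have h6 : (U.ncard : ℝ) ^ Fintype.card V - U.ncard.descFactorial (Fintype.card V)
        ≤ δ / 2 * (n : ℝ) ^ Fintype.card V := by
      rw [div_le_iff₀ hδ] at hn₂'
      have hpow : (0 : ℝ) < (n : ℝ) ^ Fintype.card V := by positivity
      refine le_of_mul_le_mul_left (h4.trans ?_) hn0
      rw [← hk]
      nlinarith
    have h7 : |H.copySum U (fun _ => (1 + y) / 2) - (1 / 2 : ℝ) ^ (Fintype.card V).choose 2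
        * (U.ncard : ℝ) ^ Fintype.card V| ≤ δ / 2 * (n : ℝ) ^ Fintype.card V := by
      rw [h3, ← mul_sub, abs_mul, abs_sub_comm, abs_of_nonneg h5,
        abs_of_nonneg (by positivity : (0 : ℝ) ≤ (1 / 2) ^ (Fintype.card V).choose 2)]
      exact (mul_le_of_le_one_left h5 (pow_le_one₀ (by norm_num) (by norm_num))).trans h6
    calc _ ≤ _ := abs_sub_le _ (H.copySum U fun _ => (1 + y) / 2) _
      _ ≤ δ / 2 * (n : ℝ) ^ Fintype.card V + δ / 2 * (n : ℝ) ^ Fintype.card V :=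
        add_le_add ((hcount U).trans (by gcongr)) h7
      _ = _ := by ring
  have hfwd := hforce (Fin n) (ofUpperTriangle x hx) (by rw [Fintype.card_fin]; omega) hloc
    (finCongr (Fintype.card_fin n).symm)
  rw [ncard_forwardEdges_ofUpperTriangle, Fintype.card_fin] at hfwd
  have h8 := (abs_le.1 hfwd).2
  have h9 : (n.choose 2 : ℝ) = n * (n - 1) / 2 := Nat.cast_choose_two ℝ n
  rw [h9] at h8 hup
  have hn2' : (2 : ℝ) ≤ n := by exact_mod_cast hn2
  have h10 : (n : ℝ) ^ 2 / 4 ≤ n * (n - 1) / 2 := by nlinarith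
  have h11 : η * (n : ℝ) ^ 2 ≤ y / 32 * (n : ℝ) ^ 2 := by gcongr
  have h12 := mul_le_mul_of_nonneg_left h10 hy0.le
  have h13 : 0 < y * (n : ℝ) ^ 2 := by positivity
  linarith

/-- At `y = 1` every backward edge contributes a factor `0`, and each ordering of a non-transitive
tournament has one. -/
lemma orderPoly_one (H : Tournament V) (hnt : ¬ H.IsTransitive) : H.orderPoly 1 = 0 := by
  refine Finset.sum_eq_zero fun σ _ => ?_
  by_contra hne
  refine hnt ⟨σ, ?_⟩
  ext e
  refine ⟨fun h => h.1, fun h => ⟨h, ?_⟩⟩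
  have := Finset.prod_ne_zero_iff.1 hne e ((H.mem_edges e).2 h)
  by_contra hlt
  exact this (by simp [osign, hlt])

lemma continuous_orderPoly (H : Tournament V) : Continuous H.orderPoly := by
  unfold orderPoly
  fun_prop

/-- A value above `h!` at `y` and the value `0` at `1` would force the excluded value `h!` in
between. -/
lemma IsLocallyForcing.orderPoly_le {H : Tournament V} (hlf : H.IsLocallyForcing)
    (hnt : ¬ H.IsTransitive) (h2 : 2 ≤ Fintype.card V) (y : ℝ) (hy0 : 0 < y) (hy1 : y < 1) :
    H.orderPoly y ≤ (Fintype.card V).factorial := by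
  by_contra! hc
  have hpos : (0 : ℝ) < (Fintype.card V).factorial := by exact_mod_cast Nat.factorial_pos _
  obtain ⟨z, hz, hzy⟩ := intermediate_value_Ioo' hy1.le H.continuous_orderPoly.continuousOn
    (show ((Fintype.card V).factorial : ℝ) ∈ Set.Ioo (H.orderPoly 1) (H.orderPoly y) from
      ⟨by rw [H.orderPoly_one hnt]; exact hpos, hc⟩)
  exact hlf.orderPoly_ne h2 (hy0.trans hz.1) hz.2 hzy

end NotLocallyForcing

end Tournament

theorem mainTheorem3 {V : Type*} [Fintype V] (h : ℕ) (hV : Fintype.card V = h)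
    (H : Tournament V) (hnt : ¬ H.IsTransitive) (hlf : H.IsLocallyForcing) :
    (∑ v : V, ((H.outDegree v : ℤ) - (H.inDegree v : ℤ)) ^ 2 ≤ (h : ℤ) * ((h : ℤ) - 1)) ∧
    (∀ σ : V ≃ Fin h,
      |((H.forwardEdges σ).ncard : ℝ) - 1 / 2 * (h.choose 2 : ℝ)|
        ≤ (h : ℝ) ^ (3 / 2 : ℝ) * Real.sqrt (Real.log (h : ℝ))) ∧
    (∀ A B : Set V, Disjoint A B →
      (H.edgesBetween A B : ℝ)
        ≤ 1 / 2 * ((A.ncard : ℝ) * (B.ncard : ℝ)) + 2 * (h : ℝ) ^ (3 / 2 : ℝ)) := by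
  subst hV
  have h2 : 2 ≤ Fintype.card V := by
    by_contra! hc
    exact hnt (H.isTransitive_of_card_le_one (by omega))
  have hP := hlf.orderPoly_le hnt h2
  exact ⟨H.sum_degree_difference_sq_le hP, H.abs_ncard_forwardEdges_sub_le h2 hP,
    H.edgesBetween_le h2 hP⟩
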